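/- Let $n\ge 1$ and let $\mathbb H^n=\mathbb C^n\times\mathbb R$ be the Heisenberg group with group law $(\zeta,t)\cdot(\zeta',t')=(\zeta+\zeta',\,t+t'+2\,\mathrm{Im}\langle\zeta,\zeta'\rangle)$, where $\langle\zeta,\zeta'\rangle=\sum_{j=1}^n\zeta_j\overline{\zeta_j'}$. Let $\mathcal L^{2n+1}$ be the Lebesgue measure on $\mathbb C^n\times\mathbb R\cong\mathbb R^{2n+1}$ (the outer measure on non-measurable sets). With $\zeta_j=\xi_j+i\eta_j$, let $d_{CC}$ be the Carnot–Carathéodory metric for which the left-invariant vector fields $X_j=\partial_{\xi_j}+2\eta_j\partial_t$, $Y_j=\partial_{\eta_j}-2\xi_j\partial_t$ $(1\le j\le n)$ are an orthonormal frame of the horizontal bundle; that is, $d_{CC}(x,y)$ is the infimum of the lengths $\int_0^r\big(\sum_j(h_j^2+k_j^2)\big)^{1/2}\,du$ over all absolutely continuous curves $\gamma:[0,r]\to\mathbb H^n$ from $x$ to $y$ with $\dot\gamma=\sum_j(h_jX_j(\gamma)+k_jY_j(\gamma))$ a.e. for some measurable $h_j,k_j:[0,r]\to\mathbb R$. For $s\in[0,1]$,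 $x\in\mathbb H^n$ and $E\subset\mathbb H^n$ put $$Z_s(x,E)=\{z\in\mathbb H^n:\ d_{CC}(x,z)=s\,d_{CC}(x,y)\ \text{and}\ d_{CC}(z,y)=(1-s)\,d_{CC}(x,y)\ \text{for some }y\in E\}.$$ For $\chi\in\mathbb C^n$ and $\theta\in\mathbb R$ let $$\Gamma_1(\chi,\theta)=\Big(i\,\tfrac{e^{-i\theta}-1}{\theta}\,\chi,\ 2|\chi|^2\,\tfrac{\theta-\sin\theta}{\theta^2}\Big)\ \text{ if }\theta\neq0,\qquad \Gamma_1(\chi,0)=(\chi,0),$$ and for nonempty measurable sets $A,B\subset\mathbb H^n$ let $$\Theta_{A,B}=\sup_{A_0,B_0}\ \inf\big\{|\theta|\in[0,2\pi]:\ \Gamma_1(\chi,\theta)=x^{-1}\cdot y\ \text{ for some }(x,y)\in A_0\times B_0,\ \chi\in\mathbb C^n\big\},$$ the supremum being over nonempty subsets $A_0\subset A$ and $B_0\subset B$ with $\mathcal L^{2n+1}(A\setminus A_0)=\mathcal L^{2n+1}(B\setminus B_0)=0$. For $s\in[0,1]$ define $\tau^n_s:[0,2\pi]\to[0,\infty]$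 by $\tau^n_s(2\pi)=+\infty$, $\tau^n_s(0)=s^{\frac{2n+3}{2n+1}}$ and $$\tau^n_s(\theta)=s^{\frac1{2n+1}}\left(\frac{\sin\frac{\theta s}2}{\sin\frac\theta2}\right)^{\frac{2n-1}{2n+1}}\left(\frac{\sin\frac{\theta s}2-\frac{\theta s}2\cos\frac{\theta s}2}{\sin\frac\theta2-\frac\theta2\cos\frac\theta2}\right)^{\frac1{2n+1}}\qquad(0<\theta<2\pi).$$ The measure contraction property $\mathrm{MCP}(0,2n+3)$ holds on $\mathbb H^n$; that is, for every $s\in[0,1]$, every $x\in\mathbb H^n$ and every nonempty Lebesgue measurable set $E\subset\mathbb H^n$, with the convention $0\cdot(+\infty)=(+\infty)\cdot0=0$, $$\mathcal L^{2n+1}(Z_s(x,E))\ \ge\ \big(\tau^n_s(\Theta_{\{x\},E})\big)^{2n+1}\,\mathcal L^{2n+1}(E)\ \ge\ s^{2n+3}\,\mathcal L^{2n+1}(E).$$ -/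

import Mathlib

open MeasureTheory Set
open scoped ENNReal

noncomputable section

namespace Heisenberg

/-- The underlying space `ℂⁿ × ℝ` of the Heisenberg group `ℍⁿ`, a point being `(ζ, t)` with
`ζ = ξ + i η`. Its `volume` is the Lebesgue measure of `ℝ²ⁿ⁺¹`. The group law is `mul` below (not
the componentwise product). -/
abbrev H (n : ℕ) : Type := (Fin n → ℂ) × ℝ

/-- The group law `(ζ, t) · (ζ', t') = (ζ + ζ', t + t' + 2 Im ⟨ζ, ζ'⟩)`, where
`⟨ζ, ζ'⟩ = ∑ ζ_j conj(ζ'_j)`. -/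
def mul {n : ℕ} (x y : H n) : H n :=
  (x.1 + y.1, x.2 + y.2 + 2 * (∑ j, x.1 j * (starRingEnd ℂ) (y.1 j)).im)

/-- The inverse `(ζ, t)⁻¹ = (-ζ, -t)`. -/
def inv {n : ℕ} (x : H n) : H n := (-x.1, -x.2)

/-- The left invariant vector field `X_j = ∂_{ξ_j} + 2 η_j ∂_t`. -/
def X {n : ℕ} (j : Fin n) (p : H n) : H n := (Pi.single j 1, 2 * (p.1 j).im)

/-- The left invariant vector field `Y_j = ∂_{η_j} - 2 ξ_j ∂_t`. -/
def Y {n : ℕ} (j : Fin n) (p : H n) : H n := (Pi.single j Complex.I, -2 * (p.1 j).re)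

/-- `c : [0, r] → ℍⁿ` is a horizontal curve, with measurable controls `h_j` (along `X_j`)
and `k_j` (along `Y_j`). -/
structure IsHorizontal {n : ℕ} (r : ℝ) (c : ℝ → H n) (h k : Fin n → ℝ → ℝ) : Prop where
  nonneg : 0 ≤ r
  absCont : AbsolutelyContinuousOnInterval c 0 r
  measurable_h : ∀ j, Measurable (h j)
  measurable_k : ∀ j, Measurable (k j)
  hasDeriv : ∀ᵐ s ∂(volume.restrict (Icc 0 r)),
    HasDerivAt c (∑ j, (h j s • X j (c s) + k j s • Y j (c s))) s

/-- The length `∫₀ʳ √(∑ (h_j² + k_j²))` of a horizontal curve with controls `h`, `k`. -/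
def length {n : ℕ} (r : ℝ) (h k : Fin n → ℝ → ℝ) : ℝ≥0∞ :=
  ∫⁻ s in Icc 0 r, ENNReal.ofReal (Real.sqrt (∑ j, (h j s ^ 2 + k j s ^ 2)))

/-- The Carnot–Carathéodory distance: the infimum of the lengths of the horizontal curves
joining `x` to `y`. -/
def dCC {n : ℕ} (x y : H n) : ℝ≥0∞ :=
  sInf {l | ∃ (r : ℝ) (c : ℝ → H n) (h k : Fin n → ℝ → ℝ),
    IsHorizontal r c h k ∧ c 0 = x ∧ c r = y ∧ l = length r h k}

/-- The set `Z_s(A, B)` of `s`-intermediate points between points of `A` and points of `B`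
with respect to the Carnot–Carathéodory distance. -/
def Z {n : ℕ} (s : ℝ) (A B : Set (H n)) : Set (H n) :=
  {z | ∃ x ∈ A, ∃ y ∈ B, dCC x z = ENNReal.ofReal s * dCC x y ∧
    dCC z y = ENNReal.ofReal (1 - s) * dCC x y}

/-- The curve `γ_{χ,θ}` issuing from the origin. -/
def geod {n : ℕ} (χ : Fin n → ℂ) (θ s : ℝ) : H n :=
  if θ = 0 then (fun j => (s : ℂ) * χ j, 0)
  else
    (fun j => Complex.I * ((Complex.exp (-Complex.I * θ * s) - 1) / θ) * χ j,
      2 * (∑ j, ‖χ j‖ ^ 2) * ((θ * s - Real.sin (θ * s)) / θ ^ 2))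

/-- The quantity `Θ_{A,B}`: the supremum, over the nonempty full measure subsets `A₀ ⊆ A` and
`B₀ ⊆ B`, of the infimum of all `|θ| ∈ [0, 2π]` such that `γ_{χ,θ}(1) = x⁻¹ · y` for some
`(x, y) ∈ A₀ × B₀` and some `χ`. -/
def Theta {n : ℕ} (A B : Set (H n)) : ℝ :=
  sSup {m | ∃ A₀ B₀ : Set (H n), A₀ ⊆ A ∧ B₀ ⊆ B ∧ A₀.Nonempty ∧ B₀.Nonempty ∧
    volume (A \ A₀) = 0 ∧ volume (B \ B₀) = 0 ∧
    m = sInf {a | ∃ x ∈ A₀, ∃ y ∈ B₀, ∃ (χ : Fin n → ℂ) (θ : ℝ),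
      |θ| ≤ 2 * Real.pi ∧ geod χ θ 1 = mul (inv x) y ∧ a = |θ|}}

/-- The Heisenberg distortion coefficient `τ_s^n(θ) ∈ [0, ∞]`, for `θ ∈ [0, 2π]`. The defining
formula is used for all `s ∈ [0, 1]`. -/
def tau (n : ℕ) (s θ : ℝ) : ℝ≥0∞ :=
  if θ = 2 * Real.pi then ⊤
  else if θ = 0 then ENNReal.ofReal (s ^ ((2 * (n : ℝ) + 3) / (2 * n + 1)))
  else ENNReal.ofReal
    (s ^ (1 / (2 * (n : ℝ) + 1)) *
      (Real.sin (θ * s / 2) / Real.sin (θ / 2)) ^ ((2 * (n : ℝ) - 1) / (2 * n + 1)) *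
      ((Real.sin (θ * s / 2) - θ * s / 2 * Real.cos (θ * s / 2)) /
        (Real.sin (θ / 2) - θ / 2 * Real.cos (θ / 2))) ^ (1 / (2 * (n : ℝ) + 1)))

end Heisenberg

end

/-! Left translations preserve distance and volume, so `x` can be moved to the origin. The curves
`geod χ θ` with `0 < |θ| < 2π` are then minimizing by a calibration argument. Let `σ` be normalized
arclength along a horizontal curve of length `L` from the origin, and let `a' = -(a² + b²)`. Up to
an `ε` that avoids the pole of `a` at `0`, the function `a(σ)|ζ|² + b t` grows at most at rate `L`
times the speed, so its final value is at most `L²` (`riccati_le_length_sq`). For `b = θ/2` and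
`a(u) = b cot(bu)` that value at `geod χ θ 1` is exactly `|χ|²`. Sliding endpoints from time `1`
back to time `s` thus leads from `E` into `Z_s`; no existence or uniqueness theory of geodesics is
needed.

Volumes are compared in the coordinates `(χ, θ)`. For fixed `θ` the point at time `s` is `(ζ, |ζ|²
rho(θs))` with `ζ` a complex multiple of `χ`, and `rho` is injective, so Tonelli and two elementary
substitutions replace a full Jacobian determinant (`lintegral_jac_eq`). At time `1` almost every
point is reached, and at time `s` none is counted twice. The ratio of the two densities is
`distortion n s (θ/2)`, the power `2n+1` of `τ_s(|θ|)`. It increases with `|θ|` and is at least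
`s^(2n+3)`. Since all angles seen by `E` are at least `Theta {x} E` up to a null set, both
inequalities follow. -/

/-! ### Absolutely continuous functions -/

theorem AbsolutelyContinuousOnInterval.lipschitzOn_comp {Y Z : Type*} [PseudoMetricSpace Y]
    [PseudoMetricSpace Z] {g : Y → Z} {f : ℝ → Y} {K : NNReal} {s : Set Y} {a b : ℝ}
    (hg : LipschitzOnWith K g s) (hf : AbsolutelyContinuousOnInterval f a b)
    (hs : MapsTo f (uIcc a b) s) : AbsolutelyContinuousOnInterval (fun x => g (f x)) a b := by
  unfold AbsolutelyContinuousOnInterval at hf ⊢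
  refine squeeze_zero' (Filter.Eventually.of_forall
    fun _ => Finset.sum_nonneg fun _ _ => dist_nonneg) ?_ (by simpa using hf.const_mul (K : ℝ))
  rw [Filter.eventually_inf_principal]
  filter_upwards with ⟨m, I⟩ hI
  rw [Finset.mul_sum]
  refine Finset.sum_le_sum fun i hi => ?_
  exact hg.dist_le_mul _ (hs (hI.1 i hi).1) _ (hs (hI.1 i hi).2)

theorem AbsolutelyContinuousOnInterval.finset_sum {ι F : Type*} [SeminormedAddCommGroup F]
    {f : ι → ℝ → F} {a b : ℝ} (s : Finset ι)
    (hf : ∀ i ∈ s, AbsolutelyContinuousOnInterval (f i) a b) :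
    AbsolutelyContinuousOnInterval (fun x => ∑ i ∈ s, f i x) a b := by
  classical
  induction s using Finset.induction_on with
  | empty =>
    simpa using (LipschitzWith.const (0 : F)).lipschitzOnWith.absolutelyContinuousOnInterval
  | insert i s hi ih =>
    simp only [Finset.sum_insert hi]
    exact (hf i (by simp)).fun_add (ih fun j hj => hf j (by simp [hj]))

theorem AbsolutelyContinuousOnInterval.sub_le_integral {f g : ℝ → ℝ} {a b : ℝ} (hab : a ≤ b)
    (hf : AbsolutelyContinuousOnInterval f a b) (hg : IntervalIntegrable g volume a b)
    (h : ∀ᵐ x ∂volume.restrict (Icc a b), ∃ f', HasDerivAt f f' x ∧ f' ≤ g x) :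
    f b - f a ≤ ∫ x in a..b, g x := by
  rw [← hf.integral_deriv_eq_sub]
  refine intervalIntegral.integral_mono_ae_restrict hab hf.intervalIntegrable_deriv hg ?_
  filter_upwards [h] with x ⟨f', h1, h2⟩
  rwa [h1.deriv]

namespace Heisenberg

variable {n : ℕ}

/-! ### The lower bound for the length of horizontal curves -/

/-- Termwise `2xy ≤ (v/L)x² + (L/v)y²`; the second terms add up to `L v` because `∑ (h² + k²) = v²`.
-/
theorem two_mul_sum_le_of_sq_add_sq {ι : Type*} [Fintype ι] (p q h k : ι → ℝ) {L v : ℝ}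
    (hL : 0 < L) (hv : v = Real.sqrt (∑ j, (h j ^ 2 + k j ^ 2))) :
    ∑ j, 2 * (p j * h j + q j * k j) ≤ v / L * ∑ j, (p j ^ 2 + q j ^ 2) + L * v := by
  have hn : 0 ≤ ∑ j, (h j ^ 2 + k j ^ 2) := Finset.sum_nonneg fun j _ => by positivity
  have hv2 : v ^ 2 = ∑ j, (h j ^ 2 + k j ^ 2) := by rw [hv, Real.sq_sqrt hn]
  have hv0 : 0 ≤ v := hv ▸ Real.sqrt_nonneg _
  rcases hv0.eq_or_lt with h0 | h0
  · have hz : ∀ j, h j ^ 2 + k j ^ 2 = 0 := by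
      have := (Finset.sum_eq_zero_iff_of_nonneg (s := Finset.univ)
        (f := fun j => h j ^ 2 + k j ^ 2) (fun j _ => by positivity)).1
        (by rw [← hv2, ← h0]; norm_num)
      exact fun j => this j (Finset.mem_univ j)
    have hh : ∀ j, h j = 0 := fun j => by nlinarith [hz j, sq_nonneg (h j), sq_nonneg (k j)]
    have hk : ∀ j, k j = 0 := fun j => by nlinarith [hz j, sq_nonneg (h j), sq_nonneg (k j)]
    simp [hh, hk, ← h0]
  · have e : v / L * ∑ j, (p j ^ 2 + q j ^ 2) + L * v
        = ∑ j, (v / L * (p j ^ 2 + q j ^ 2) + L / v * (h j ^ 2 + k j ^ 2)) := by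
      symm
      rw [Finset.sum_add_distrib, ← Finset.mul_sum, ← Finset.mul_sum, ← hv2]
      field_simp
    rw [e]
    refine Finset.sum_le_sum fun j _ => ?_
    have key : ∀ x y : ℝ, 2 * (x * y) ≤ v / L * x ^ 2 + L / v * y ^ 2 := fun x y => by
      have : v / L * x ^ 2 + L / v * y ^ 2 - 2 * (x * y) = (v * x - L * y) ^ 2 / (L * v) := by
        field_simp; ring
      have : 0 ≤ (v * x - L * y) ^ 2 / (L * v) := by positivity
      linarith
    linarith [key (p j) (h j), key (q j) (k j)]

section Horizontal

variable {r : ℝ} {c : ℝ → H n} {h k : Fin n → ℝ → ℝ}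

theorem sum_smul_X_Y_fst (a b : Fin n → ℝ) (p : H n) (i : Fin n) :
    (∑ j, (a j • X j p + b j • Y j p)).1 i = ⟨a i, b i⟩ := by
  simp only [Prod.fst_sum, Finset.sum_apply, X, Y, Prod.fst_add, Prod.smul_fst, Pi.add_apply,
    Pi.smul_apply, Finset.sum_add_distrib, Pi.single_apply, smul_ite, smul_zero,
    Finset.sum_ite_eq, Finset.mem_univ, if_true]
  apply Complex.ext <;> simp

theorem sum_smul_X_Y_snd (a b : Fin n → ℝ) (p : H n) :
    (∑ j, (a j • X j p + b j • Y j p)).2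
      = ∑ j, 2 * (a j * (p.1 j).im - b j * (p.1 j).re) := by
  simp only [Prod.snd_sum, X, Y, Prod.snd_add, Prod.smul_snd, smul_eq_mul]
  exact Finset.sum_congr rfl fun j _ => by ring

theorem hasDerivAt_iff_components {c : ℝ → H n} {c' : H n} {x : ℝ} :
    HasDerivAt c c' x ↔ (∀ i, HasDerivAt (fun s => ((c s).1 i).re) (c'.1 i).re x ∧
      HasDerivAt (fun s => ((c s).1 i).im) (c'.1 i).im x) ∧
      HasDerivAt (fun s => (c s).2) c'.2 x := by
  constructor
  · intro hc
    have h1 : HasDerivAt (fun s => (c s).1) c'.1 x := hc.fst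
    rw [hasDerivAt_pi] at h1
    refine ⟨fun i => ⟨?_, ?_⟩, hc.snd⟩
    · exact (Complex.reCLM.hasFDerivAt.comp_hasDerivAt x (h1 i))
    · exact (Complex.imCLM.hasFDerivAt.comp_hasDerivAt x (h1 i))
  · rintro ⟨h1, h2⟩
    refine HasDerivAt.prodMk (f₁ := fun s => (c s).1) (f₂ := fun s => (c s).2) ?_ h2
    rw [hasDerivAt_pi]
    intro i
    have e := ((h1 i).1.ofReal_comp).fun_add (((h1 i).2.ofReal_comp).mul_const Complex.I)
    simpa [Complex.re_add_im] using e

/-- A completion of squares along a solution of the Riccati equation `a' = -(a² + b²)` bounds the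
length of a horizontal curve issuing from the origin from below. -/
theorem IsHorizontal.riccati_le_length_sq (hc : IsHorizontal r c h k) (h0 : c 0 = 0)
    (hL : length r h k ≠ ⊤) {a : ℝ → ℝ} {b : ℝ} (ha : ContDiffOn ℝ 1 a (Ioc 0 1))
    (ha' : ∀ u ∈ Ioc (0 : ℝ) 1, HasDerivAt a (-(a u ^ 2 + b ^ 2)) u) :
    a 1 * ∑ j, ‖(c r).1 j‖ ^ 2 + b * (c r).2 ≤ (length r h k).toReal ^ 2 := by
  have hr := hc.nonneg
  set L := (length r h k).toReal with hLdef
  set v : ℝ → ℝ := fun s => Real.sqrt (∑ j, (h j s ^ 2 + k j s ^ 2)) with hv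
  have hv0 : ∀ s, 0 ≤ v s := fun s => Real.sqrt_nonneg _
  have hvm : Measurable v := by
    refine (Finset.measurable_sum _ fun j _ => ?_).sqrt
    exact ((hc.measurable_h j).pow_const 2).add ((hc.measurable_k j).pow_const 2)
  have hvi : IntegrableOn v (Icc 0 r) := by
    refine ⟨hvm.aestronglyMeasurable, ?_⟩
    rw [hasFiniteIntegral_iff_ofReal (Filter.Eventually.of_forall hv0)]
    exact hL.lt_top
  have hvii : IntervalIntegrable v volume 0 r :=
    (intervalIntegrable_iff_integrableOn_Icc_of_le hr).2 hvi
  have hLint : ∫ s in (0)..r, v s = L := by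
    rw [intervalIntegral.integral_of_le hr, ← integral_Icc_eq_integral_Ioc,
      integral_eq_lintegral_of_nonneg_ae (Filter.Eventually.of_forall hv0)
        hvm.aestronglyMeasurable]
    rfl
  have hL0 : 0 ≤ L := ENNReal.toReal_nonneg
  -- The solution `a` may blow up at `0`, so arclength is started at `ε` instead and normalized by
  -- `M = L + ε`.
  suffices H : ∀ ε > 0, a 1 * ∑ j, ‖(c r).1 j‖ ^ 2 + b * (c r).2 ≤ (L + ε) * L by
    refine le_of_forall_pos_le_add fun δ hδ => ?_
    have := H (δ / (L + 1)) (by positivity)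
    have e : δ / (L + 1) * L ≤ δ := by
      rw [div_mul_eq_mul_div, div_le_iff₀ (by positivity)]; nlinarith
    nlinarith
  intro ε hε
  set M := L + ε with hM
  have hM0 : 0 < M := by positivity
  set σ : ℝ → ℝ := fun x => (ε + ∫ s in (0)..x, v s) / M with hσ
  have hσac : AbsolutelyContinuousOnInterval σ 0 r := by
    have h1 := hvii.absolutelyContinuousOnInterval_intervalIntegral (c := 0) (by simp)
    have h2 : AbsolutelyContinuousOnInterval (fun _ : ℝ => ε) 0 r :=
      (LipschitzWith.const ε).lipschitzOnWith.absolutelyContinuousOnInterval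
    have := (h2.fun_add h1).const_mul M⁻¹
    simpa [hσ, div_eq_inv_mul] using this
  have hσmem : ∀ x ∈ Icc 0 r, σ x ∈ Icc (ε / M) 1 := by
    intro x hx
    have i1 : 0 ≤ ∫ s in (0)..x, v s := intervalIntegral.integral_nonneg hx.1 fun s _ => hv0 s
    have i2 : ∫ s in (0)..x, v s ≤ L := by
      rw [← hLint]
      exact intervalIntegral.integral_mono_interval le_rfl hx.1 hx.2
        (Filter.Eventually.of_forall hv0) hvii
    simp only [hσ, mem_Icc]
    constructor
    · gcongr; linarith
    · rw [div_le_one hM0]; linarith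
  have hsub : Icc (ε / M) 1 ⊆ Ioc (0 : ℝ) 1 := fun u hu => ⟨lt_of_lt_of_le (by positivity) hu.1, hu.2⟩
  obtain ⟨K, hK⟩ := (ha.mono hsub).exists_lipschitzOnWith one_ne_zero (convex_Icc _ _) isCompact_Icc
  have hAac : AbsolutelyContinuousOnInterval (fun x => a (σ x)) 0 r :=
    hσac.lipschitzOn_comp hK (by rw [uIcc_of_le hr]; exact hσmem)
  have hac := hc.absCont
  have hre : ∀ j, AbsolutelyContinuousOnInterval (fun s => ((c s).1 j).re) 0 r := fun j =>
    hac.lipschitzOn_comp (g := fun p : H n => (p.1 j).re) (s := univ) (K := 1)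
      (by
        refine LipschitzWith.lipschitzOnWith (LipschitzWith.of_dist_le_mul fun p q => ?_)
        rw [Real.dist_eq, ← Complex.sub_re, NNReal.coe_one, one_mul]
        refine (Complex.abs_re_le_norm _).trans ?_
        rw [← dist_eq_norm]
        exact (dist_le_pi_dist p.1 q.1 j).trans (le_max_left _ _)) (mapsTo_univ _ _)
  have him : ∀ j, AbsolutelyContinuousOnInterval (fun s => ((c s).1 j).im) 0 r := fun j =>
    hac.lipschitzOn_comp (g := fun p : H n => (p.1 j).im) (s := univ) (K := 1)
      (by
        refine LipschitzWith.lipschitzOnWith (LipschitzWith.of_dist_le_mul fun p q => ?_)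
        rw [Real.dist_eq, ← Complex.sub_im, NNReal.coe_one, one_mul]
        refine (Complex.abs_im_le_norm _).trans ?_
        rw [← dist_eq_norm]
        exact (dist_le_pi_dist p.1 q.1 j).trans (le_max_left _ _)) (mapsTo_univ _ _)
  have ht : AbsolutelyContinuousOnInterval (fun s => (c s).2) 0 r :=
    hac.lipschitzOn_comp (g := fun p : H n => p.2) (s := univ) (K := 1)
      LipschitzWith.prod_snd.lipschitzOnWith (mapsTo_univ _ _)
  set N : ℝ → ℝ := fun s => ∑ j, (((c s).1 j).re * ((c s).1 j).re +
    ((c s).1 j).im * ((c s).1 j).im) with hN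
  have hNac : AbsolutelyContinuousOnInterval N 0 r :=
    AbsolutelyContinuousOnInterval.finset_sum _ fun j _ =>
      ((hre j).fun_mul (hre j)).fun_add ((him j).fun_mul (him j))
  have hΦ := (hAac.fun_mul hNac).fun_add (ht.const_mul b)
  have hσd : ∀ᵐ x ∂volume.restrict (Icc 0 r), HasDerivAt σ (v x / M) x := by
    rw [ae_restrict_iff' measurableSet_Icc]
    filter_upwards [hvii.ae_hasDerivAt_integral] with x hx hx'
    rw [← uIcc_of_le hr] at hx'
    exact ((hx hx' 0 (by simp)).const_add ε).div_const M
  have key := hΦ.sub_le_integral hr (hvii.const_mul M) (by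
    filter_upwards [hc.hasDeriv, hσd, ae_restrict_mem measurableSet_Icc] with x hx hxσ hxm
    rw [hasDerivAt_iff_components, sum_smul_X_Y_snd] at hx
    simp only [sum_smul_X_Y_fst] at hx
    obtain ⟨hx1, hx2⟩ := hx
    have dA : HasDerivAt (fun x => a (σ x)) _ x :=
      HasDerivAt.comp x (ha' (σ x) (hsub (hσmem x hxm))) hxσ
    have dN : HasDerivAt N _ x := HasDerivAt.fun_sum fun j _ =>
      ((hx1 j).1.mul (hx1 j).1).add ((hx1 j).2.mul (hx1 j).2)
    refine ⟨_, (dA.mul dN).add (hx2.const_mul b), ?_⟩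
    -- These vectors collect the coefficients of the controls in `a N' + b t'`. Their squares sum to
    -- `(a² + b²) N`, which the Riccati term `-(a² + b²) N v / M` cancels, leaving `M v`.
    have e := two_mul_sum_le_of_sq_add_sq
      (fun j => a (σ x) * ((c x).1 j).re + b * ((c x).1 j).im)
      (fun j => a (σ x) * ((c x).1 j).im - b * ((c x).1 j).re)
      (fun j => h j x) (fun j => k j x) hM0 (v := v x) rfl
    have e1 : ∑ j, ((a (σ x) * ((c x).1 j).re + b * ((c x).1 j).im) ^ 2 +
        (a (σ x) * ((c x).1 j).im - b * ((c x).1 j).re) ^ 2)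
        = (a (σ x) ^ 2 + b ^ 2) * N x := by
      rw [hN, Finset.mul_sum]
      exact Finset.sum_congr rfl fun j _ => by ring
    rw [e1] at e
    have e2 : a (σ x) * ∑ j, (h j x * ((c x).1 j).re + ((c x).1 j).re * h j x +
          (k j x * ((c x).1 j).im + ((c x).1 j).im * k j x)) +
        b * ∑ j, 2 * (h j x * ((c x).1 j).im - k j x * ((c x).1 j).re) =
        ∑ j, 2 * ((a (σ x) * ((c x).1 j).re + b * ((c x).1 j).im) * h j x +
          (a (σ x) * ((c x).1 j).im - b * ((c x).1 j).re) * k j x) := by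
      rw [Finset.mul_sum, Finset.mul_sum, ← Finset.sum_add_distrib]
      exact Finset.sum_congr rfl fun j _ => by ring
    calc _ = -((a (σ x) ^ 2 + b ^ 2) * N x) * (v x / M) + (a (σ x) *
          ∑ j, (h j x * ((c x).1 j).re + ((c x).1 j).re * h j x +
          (k j x * ((c x).1 j).im + ((c x).1 j).im * k j x)) +
        b * ∑ j, 2 * (h j x * ((c x).1 j).im - k j x * ((c x).1 j).re)) := by ring
      _ ≤ _ := by rw [e2]; linarith)
  have hN0 : N 0 = 0 := by simp [hN, h0]
  have hNr : N r = ∑ j, ‖(c r).1 j‖ ^ 2 := by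
    simp only [hN]
    exact Finset.sum_congr rfl fun j _ => by
      rw [← Complex.normSq_eq_norm_sq, Complex.normSq_apply]
  have hσr : σ r = 1 := by
    simp only [hσ, hLint]
    rw [div_eq_one_iff_eq hM0.ne', hM]; ring
  rw [intervalIntegral.integral_const_mul, hLint] at key
  simp only [hN0, hNr, hσr, h0] at key
  simpa using key

end Horizontal

/-! ### The group law and left invariance of the distance -/

theorem mul_assoc' (x y z : H n) : mul (mul x y) z = mul x (mul y z) := by
  refine Prod.ext ?_ ?_
  · simp [mul, add_assoc]
  · simp only [mul, Pi.add_apply, map_add, mul_add, add_mul, Finset.sum_add_distrib,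
      Complex.add_im]
    ring

theorem zero_mul' (x : H n) : mul 0 x = x := by simp [mul]

theorem mul_zero' (x : H n) : mul x 0 = x := by simp [mul]

theorem inv_mul_self (x : H n) : mul (inv x) x = 0 := by
  refine Prod.ext ?_ ?_ <;> simp [mul, inv, Complex.mul_conj]

theorem inv_mul_cancel_left' (x y : H n) : mul (inv x) (mul x y) = y := by
  rw [← mul_assoc', inv_mul_self, zero_mul']

theorem contDiff_mul_left (x : H n) : ContDiff ℝ 1 (mul x) := by
  have h1 : ∀ j, ContDiff ℝ 1 fun p : H n => (x.1 j * (starRingEnd ℂ) (p.1 j)).im := fun j => by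
    have : (fun p : H n => (x.1 j * (starRingEnd ℂ) (p.1 j)).im)
        = fun p : H n => Complex.imCLM (x.1 j * Complex.conjCLE (p.1 j)) := rfl
    rw [this]
    fun_prop
  have : mul x = fun p : H n => (x.1 + p.1,
      x.2 + p.2 + 2 * (∑ j, (x.1 j * (starRingEnd ℂ) (p.1 j)).im)) := by
    ext p <;> simp [mul, Complex.im_sum, -Complex.mul_im]
  rw [this]
  fun_prop

theorem continuous_mul_left (x : H n) : Continuous (mul x) := (contDiff_mul_left x).continuous

/-- The frame `X`, `Y` is left invariant, so the translated curve keeps its controls and hence its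
length. -/
theorem IsHorizontal.mul_left {r : ℝ} {c : ℝ → H n} {h k : Fin n → ℝ → ℝ}
    (hc : IsHorizontal r c h k) (x : H n) : IsHorizontal r (fun s => mul x (c s)) h k where
  nonneg := hc.nonneg
  absCont := by
    obtain ⟨C, hC⟩ := hc.absCont.exists_bound
    obtain ⟨K, hK⟩ := ((contDiff_mul_left x).contDiffOn
      (s := Metric.closedBall 0 C)).exists_lipschitzOnWith one_ne_zero (convex_closedBall _ _)
        (isCompact_closedBall _ _)
    exact hc.absCont.lipschitzOn_comp hK fun s hs => by simpa using hC s hs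
  measurable_h := hc.measurable_h
  measurable_k := hc.measurable_k
  hasDeriv := by
    filter_upwards [hc.hasDeriv] with s hs
    rw [hasDerivAt_iff_components, sum_smul_X_Y_snd] at hs ⊢
    simp only [sum_smul_X_Y_fst] at hs ⊢
    obtain ⟨h1, h2⟩ := hs
    refine ⟨fun i => ⟨?_, ?_⟩, ?_⟩
    · simpa [mul] using (h1 i).1.const_add (x.1 i).re
    · simpa [mul] using (h1 i).2.const_add (x.1 i).im
    · have e := (h2.const_add x.2).fun_add ((HasDerivAt.fun_sum (u := Finset.univ) fun j _ =>
        ((h1 j).1.const_mul (x.1 j).im).fun_sub ((h1 j).2.const_mul (x.1 j).re)).const_mul 2)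
      refine (e.congr_of_eventuallyEq (Filter.Eventually.of_forall fun u => ?_)).congr_deriv ?_
      · simp only [mul, Complex.im_sum, Complex.mul_im, Complex.conj_re, Complex.conj_im]
        congr 2
        exact Finset.sum_congr rfl fun j _ => by ring
      · rw [Finset.mul_sum, ← Finset.sum_add_distrib]
        refine Finset.sum_congr rfl fun j _ => ?_
        simp only [mul, Pi.add_apply, Complex.add_re, Complex.add_im]
        ring

theorem dCC_mul_left_le (x y z : H n) : dCC (mul x y) (mul x z) ≤ dCC y z := by
  refine le_sInf ?_
  rintro l ⟨r, c, h, k, hc, h0, hr, rfl⟩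
  exact sInf_le ⟨r, _, h, k, hc.mul_left x, by simp only [h0], by simp only [hr], rfl⟩

theorem dCC_mul_left (x y z : H n) : dCC (mul x y) (mul x z) = dCC y z := by
  refine le_antisymm (dCC_mul_left_le x y z) ?_
  simpa only [inv_mul_cancel_left'] using dCC_mul_left_le (inv x) (mul x y) (mul x z)

/-! ### The curves `geod` and their minimality -/

/-- The Euclidean norm of a vector of `ℂⁿ`. -/
noncomputable def eNorm (χ : Fin n → ℂ) : ℝ := Real.sqrt (∑ j, ‖χ j‖ ^ 2)

theorem eNorm_nonneg (χ : Fin n → ℂ) : 0 ≤ eNorm χ := Real.sqrt_nonneg _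

theorem eNorm_sq (χ : Fin n → ℂ) : eNorm χ ^ 2 = ∑ j, ‖χ j‖ ^ 2 :=
  Real.sq_sqrt (Finset.sum_nonneg fun _ _ => by positivity)

theorem eNorm_smul (z : ℂ) (χ : Fin n → ℂ) : eNorm (z • χ) = ‖z‖ * eNorm χ := by
  have : ∑ j, ‖(z • χ) j‖ ^ 2 = ‖z‖ ^ 2 * ∑ j, ‖χ j‖ ^ 2 := by
    rw [Finset.mul_sum]
    simp [mul_pow]
  rw [eNorm, eNorm, this, Real.sqrt_mul (sq_nonneg _), Real.sqrt_sq (norm_nonneg z)]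

theorem exp_neg_I_mul (θ s : ℝ) :
    Complex.exp (-Complex.I * θ * s) = ⟨Real.cos (θ * s), -Real.sin (θ * s)⟩ := by
  have : -Complex.I * θ * s = ((-(θ * s) : ℝ) : ℂ) * Complex.I := by push_cast; ring
  rw [this, Complex.exp_mul_I, ← Complex.ofReal_cos, ← Complex.ofReal_sin, Real.cos_neg,
    Real.sin_neg]
  generalize Real.cos (θ * s) = a
  generalize Real.sin (θ * s) = b
  apply Complex.ext <;> simp

/-- The complex factor by which `χ` is multiplied in the first component of `geod χ θ s`. -/
noncomputable def kap (θ s : ℝ) : ℂ := ⟨Real.sin (θ * s) / θ, (Real.cos (θ * s) - 1) / θ⟩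

theorem geod_eq {θ : ℝ} (hθ : θ ≠ 0) (χ : Fin n → ℂ) (s : ℝ) :
    geod χ θ s = (kap θ s • χ, 2 * eNorm χ ^ 2 * ((θ * s - Real.sin (θ * s)) / θ ^ 2)) := by
  rw [geod, if_neg hθ, eNorm_sq]
  refine Prod.ext ?_ rfl
  funext j
  simp only [exp_neg_I_mul, Pi.smul_apply, smul_eq_mul]
  congr 1
  apply Complex.ext <;> simp [kap, Complex.div_re, Complex.div_im] <;> field_simp

theorem normSq_kap (θ s : ℝ) : ‖kap θ s‖ ^ 2 = 2 * (1 - Real.cos (θ * s)) / θ ^ 2 := by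
  rw [← Complex.normSq_eq_norm_sq, Complex.normSq_apply, kap]
  have := Real.sin_sq_add_cos_sq (θ * s)
  simp only
  rw [← sub_eq_zero]
  ring_nf
  rw [Real.sin_sq]; ring

theorem geod_zero {θ : ℝ} (hθ : θ ≠ 0) (χ : Fin n → ℂ) : geod χ θ 0 = 0 := by
  rw [geod_eq hθ]
  have : kap θ 0 = 0 := by apply Complex.ext <;> simp [kap]
  simp [this]

/-- The rotation of the initial direction along `geod`. -/
noncomputable def rot (θ s : ℝ) : ℂ := ⟨Real.cos (θ * s), -Real.sin (θ * s)⟩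

theorem norm_rot (θ s : ℝ) : ‖rot θ s‖ = 1 := by
  have : ‖rot θ s‖ ^ 2 = 1 := by
    rw [← Complex.normSq_eq_norm_sq, Complex.normSq_apply, rot]
    have := Real.sin_sq_add_cos_sq (θ * s)
    simp only; nlinarith
  nlinarith [norm_nonneg (rot θ s)]

/-- An arc of `geod` is a left translate of an arc from the origin with rotated initial direction,
which reduces distances along the curve to distances from the origin. -/
theorem geod_add {θ : ℝ} (hθ : θ ≠ 0) (χ : Fin n → ℂ) (s δ : ℝ) :
    geod χ θ (s + δ) = mul (geod χ θ s) (geod (rot θ s • χ) θ δ) := by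
  rw [geod_eq hθ, geod_eq hθ, geod_eq hθ, eNorm_smul, norm_rot, one_mul, mul]
  have hk : kap θ (s + δ) = kap θ s + kap θ δ * rot θ s := by
    apply Complex.ext <;>
    simp only [kap, rot, Complex.add_re, Complex.add_im, Complex.mul_re, Complex.mul_im,
      mul_add, Real.sin_add, Real.cos_add] <;> field_simp <;> ring
  refine Prod.ext ?_ ?_
  · simp only [hk, add_smul, mul_smul]
  · simp only [Pi.smul_apply, smul_eq_mul, map_mul]
    have e : ∀ j, kap θ s * χ j * ((starRingEnd ℂ) (kap θ δ) * ((starRingEnd ℂ) (rot θ s) *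
        (starRingEnd ℂ) (χ j))) = ((‖χ j‖ ^ 2 : ℝ) : ℂ) * (kap θ s *
          ((starRingEnd ℂ) (kap θ δ) * (starRingEnd ℂ) (rot θ s))) := fun j => by
      rw [← Complex.normSq_eq_norm_sq, ← Complex.mul_conj]; ring
    simp only [e]
    rw [← Finset.sum_mul, ← Complex.ofReal_sum, ← eNorm_sq, Complex.im_ofReal_mul]
    simp only [kap, rot, Complex.mul_re, Complex.mul_im, Complex.conj_re, Complex.conj_im,
      mul_add, Real.sin_add]
    have h1 := Real.sin_sq_add_cos_sq (θ * s)
    field_simp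
    have h2 : Real.sin (θ * s) ^ 2 = 1 - Real.cos (θ * s) ^ 2 := by linarith
    ring_nf
    simp only [h2]
    ring

theorem geod_eq_geod_one {θ s : ℝ} (hθ : θ ≠ 0) (hs : s ≠ 0) (χ : Fin n → ℂ) :
    geod χ θ s = geod ((s : ℂ) • χ) (θ * s) 1 := by
  rw [geod_eq hθ, geod_eq (mul_ne_zero hθ hs), eNorm_smul]
  have hk : kap θ s = kap (θ * s) 1 * s := by
    apply Complex.ext <;> simp [kap] <;> field_simp
  refine Prod.ext ?_ ?_
  · simp only [hk, mul_smul]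
  · simp only [Complex.norm_real, Real.norm_eq_abs, mul_pow, sq_abs, mul_one]
    field_simp

theorem isHorizontal_geod {θ : ℝ} (hθ : θ ≠ 0) (χ : Fin n → ℂ) (s : ℝ) {r : ℝ} (hr : 0 ≤ r) :
    IsHorizontal r (fun u => geod χ θ (s + u)) (fun j u => (rot θ (s + u) * χ j).re)
      (fun j u => (rot θ (s + u) * χ j).im) where
  nonneg := hr
  absCont := by
    refine ContDiffOn.absolutelyContinuousOnInterval (ContDiff.contDiffOn ?_)
    simp only [geod, if_neg hθ]
    have h1 : ContDiff ℝ 1 fun u : ℝ => Complex.exp (-Complex.I * θ * ((s + u : ℝ) : ℂ)) := by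
      have : ContDiff ℝ 1 fun u : ℝ => (u : ℂ) := Complex.ofRealCLM.contDiff
      exact (contDiff_const.mul (this.comp (contDiff_const.add contDiff_id))).cexp
    have h2 : ContDiff ℝ 1 fun u : ℝ => Real.sin (θ * (s + u)) := by fun_prop
    fun_prop
  measurable_h := fun j => by
    have : Measurable fun u => Real.cos (θ * (s + u)) * (χ j).re
      - -Real.sin (θ * (s + u)) * (χ j).im := by fun_prop
    simpa [rot] using this
  measurable_k := fun j => by
    have : Measurable fun u => Real.cos (θ * (s + u)) * (χ j).im
      + -Real.sin (θ * (s + u)) * (χ j).re := by fun_prop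
    simpa [rot] using this
  hasDeriv := by
    refine Filter.Eventually.of_forall fun u => ?_
    have dθ : HasDerivAt (fun u => θ * (s + u)) θ u := by
      simpa using ((hasDerivAt_id u).const_add s).const_mul θ
    have ds : HasDerivAt (fun u => Real.sin (θ * (s + u)) / θ) (Real.cos (θ * (s + u))) u := by
      exact (dθ.sin.div_const θ).congr_deriv (by field_simp)
    have dc : HasDerivAt (fun u => (Real.cos (θ * (s + u)) - 1) / θ) (-Real.sin (θ * (s + u))) u := by
      exact ((dθ.cos.sub_const 1).div_const θ).congr_deriv (by field_simp)
    rw [hasDerivAt_iff_components, sum_smul_X_Y_snd]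
    simp only [sum_smul_X_Y_fst, geod_eq hθ, kap, rot, Pi.smul_apply, smul_eq_mul,
      Complex.mul_re, Complex.mul_im]
    refine ⟨fun i => ⟨?_, ?_⟩, ?_⟩
    · exact (ds.mul_const _).fun_sub (dc.mul_const _)
    · exact (ds.mul_const _).fun_add (dc.mul_const _)
    · have d := (((dθ.fun_sub dθ.sin).div_const (θ ^ 2))).const_mul (2 * eNorm χ ^ 2)
      refine d.congr_deriv ?_
      symm
      rw [eNorm_sq, Finset.mul_sum, Finset.sum_mul]
      refine Finset.sum_congr rfl fun j _ => ?_
      rw [← Complex.normSq_eq_norm_sq, Complex.normSq_apply]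
      have h1 := Real.sin_sq_add_cos_sq (θ * (s + u))
      have h2 : Real.sin (θ * (s + u)) ^ 2 = 1 - Real.cos (θ * (s + u)) ^ 2 := by linarith
      field_simp
      ring_nf
      simp only [mul_add] at h2
      simp only [h2]
      ring

theorem dCC_geod_le {θ : ℝ} (hθ : θ ≠ 0) (χ : Fin n → ℂ) (s : ℝ) {δ : ℝ} (hδ : 0 ≤ δ) :
    dCC (geod χ θ s) (geod χ θ (s + δ)) ≤ ENNReal.ofReal (δ * eNorm χ) := by
  refine sInf_le ⟨δ, _, _, _, isHorizontal_geod hθ χ s hδ, by simp, rfl, ?_⟩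
  have : ∀ u, Real.sqrt (∑ j, ((rot θ (s + u) * χ j).re ^ 2 + (rot θ (s + u) * χ j).im ^ 2))
      = eNorm χ := fun u => by
    rw [← one_mul (eNorm χ), ← norm_rot θ (s + u), ← eNorm_smul, eNorm]
    congr 1
    refine Finset.sum_congr rfl fun j _ => ?_
    rw [← Complex.normSq_eq_norm_sq, Complex.normSq_apply]
    simp only [Pi.smul_apply, smul_eq_mul]
    ring
  simp only [length, this]
  rw [setLIntegral_const, Real.volume_Icc, sub_zero, ← ENNReal.ofReal_mul (eNorm_nonneg χ),
    mul_comm]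

/-- The Riccati solution is `a(u) = b cot(bu)` with `b = θ/2`, regular on `(0, 1]` because `|b| <
π`. At the endpoint `a(1)|ζ|² = |χ|² sin b cos b / b` and `b t = |χ|² (1 - sin b cos b / b)`, which
sum to `|χ|²`. -/
theorem le_dCC_zero_geod {θ : ℝ} (hθ : θ ≠ 0) (hθ' : |θ| < 2 * Real.pi) (χ : Fin n → ℂ) :
    ENNReal.ofReal (eNorm χ) ≤ dCC 0 (geod χ θ 1) := by
  refine le_sInf ?_
  rintro l ⟨r, c, h, k, hc, h0, hr, rfl⟩
  by_cases hL : length r h k = ⊤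
  · rw [hL]; exact le_top
  set b := θ / 2 with hb
  have hb0 : b ≠ 0 := by positivity
  have hbπ : |b| < Real.pi := by rw [hb, abs_div, abs_two]; linarith
  have hsin : ∀ u ∈ Ioc (0 : ℝ) 1, Real.sin (b * u) ≠ 0 := by
    intro u hu
    have h1 : |b * u| < Real.pi := by
      rw [abs_mul, abs_of_pos hu.1]; nlinarith [hu.2, abs_nonneg b]
    rw [abs_lt] at h1
    intro h2
    rw [Real.sin_eq_zero_iff_of_lt_of_lt h1.1 h1.2] at h2
    exact mul_ne_zero hb0 hu.1.ne' h2
  have hs1 : Real.sin b ≠ 0 := by simpa using hsin 1 (by simp)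
  have key := hc.riccati_le_length_sq h0 hL
    (a := fun u => b * Real.cos (b * u) / Real.sin (b * u)) (b := b)
    (ContDiffOn.div (by fun_prop) (by fun_prop) hsin) (fun u hu => by
      have d : HasDerivAt (fun u => b * u) b u := by simpa using (hasDerivAt_id u).const_mul b
      refine ((d.cos.const_mul b).fun_div d.sin (hsin u hu)).congr_deriv ?_
      have := hsin u hu
      field_simp
      ring)
  rw [hr, ← eNorm_sq, geod_eq hθ, eNorm_smul, mul_pow, normSq_kap] at key
  have e : eNorm χ ^ 2 ≤ (length r h k).toReal ^ 2 := by
    refine le_trans (le_of_eq ?_) key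
    have hθb : θ = 2 * b := by rw [hb]; ring
    simp only [mul_one, hθb, Real.cos_two_mul, Real.sin_two_mul]
    have hc2 : Real.cos b ^ 2 = 1 - Real.sin b ^ 2 := by
      linarith [Real.sin_sq_add_cos_sq b]
    rw [hc2]
    field_simp
    ring
  rw [← ENNReal.ofReal_toReal hL]
  exact ENNReal.ofReal_le_ofReal (le_of_sq_le_sq e ENNReal.toReal_nonneg)

theorem dCC_geod {θ : ℝ} (hθ : θ ≠ 0) (hθ' : |θ| < 2 * Real.pi) (χ : Fin n → ℂ) {s δ : ℝ}
    (hδ : 0 ≤ δ) (hδ1 : δ ≤ 1) :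
    dCC (geod χ θ s) (geod χ θ (s + δ)) = ENNReal.ofReal (δ * eNorm χ) := by
  refine le_antisymm (dCC_geod_le hθ χ s hδ) ?_
  rcases hδ.eq_or_lt with rfl | h0
  · simp
  rw [geod_add hθ]
  nth_rw 1 [← mul_zero' (geod χ θ s)]
  rw [dCC_mul_left, geod_eq_geod_one hθ h0.ne']
  refine le_trans (le_of_eq ?_) (le_dCC_zero_geod (mul_ne_zero hθ h0.ne') ?_ _)
  · rw [eNorm_smul, eNorm_smul, norm_rot, Complex.norm_real, Real.norm_of_nonneg hδ, one_mul]
  · rw [abs_mul, abs_of_pos h0]; nlinarith [abs_nonneg θ]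

theorem mul_geod_mem_Z {θ : ℝ} (hθ : θ ≠ 0) (hθ' : |θ| < 2 * Real.pi) (χ : Fin n → ℂ) {s : ℝ}
    (hs : s ∈ Icc (0 : ℝ) 1) {x : H n} {E : Set (H n)} (hE : mul x (geod χ θ 1) ∈ E) :
    mul x (geod χ θ s) ∈ Z s {x} E := by
  refine ⟨x, rfl, _, hE, ?_, ?_⟩
  · nth_rw 1 3 [← mul_zero' x]
    rw [dCC_mul_left, dCC_mul_left, ← geod_zero hθ χ]
    have h1 := dCC_geod hθ hθ' χ (s := 0) hs.1 hs.2
    have h2 := dCC_geod hθ hθ' χ (s := 0) zero_le_one le_rfl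
    rw [zero_add] at h1 h2
    rw [h1, h2, one_mul, ENNReal.ofReal_mul hs.1]
  · nth_rw 3 [← mul_zero' x]
    rw [dCC_mul_left, dCC_mul_left, ← geod_zero hθ χ]
    have h1 := dCC_geod hθ hθ' χ (s := s) (sub_nonneg.2 hs.2) (by linarith [hs.1])
    have h2 := dCC_geod hθ hθ' χ (s := 0) zero_le_one le_rfl
    rw [add_sub_cancel] at h1
    rw [zero_add] at h2
    rw [h1, h2, one_mul, ENNReal.ofReal_mul (sub_nonneg.2 hs.2)]

/-! ### Monotonicity and lower bound of the distortion coefficient -/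

theorem nonneg_of_hasDerivAt_nonneg {f f' : ℝ → ℝ} {b : ℝ} (hf : ∀ x, HasDerivAt f (f' x) x)
    (h0 : f 0 = 0) (h : ∀ x ∈ Ioo 0 b, 0 ≤ f' x) {x : ℝ} (hx : x ∈ Icc 0 b) : 0 ≤ f x := by
  have := monotoneOn_of_deriv_nonneg (convex_Icc 0 b)
    (fun y _ => (hf y).continuousAt.continuousWithinAt)
    (fun y _ => (hf y).differentiableAt.differentiableWithinAt)
    (fun y hy => by rw [(hf y).deriv]; rw [interior_Icc] at hy; exact h y hy)
  rw [← h0]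
  exact this ⟨le_rfl, hx.1.trans hx.2⟩ hx hx.1

/-- The function `x ↦ sin x - x cos x`. -/
noncomputable def smc (x : ℝ) : ℝ := Real.sin x - x * Real.cos x

theorem hasDerivAt_smc (x : ℝ) : HasDerivAt smc (x * Real.sin x) x := by
  refine ((Real.hasDerivAt_sin x).fun_sub
    ((hasDerivAt_id x).fun_mul (Real.hasDerivAt_cos x))).congr_deriv ?_
  simp

theorem smc_neg (x : ℝ) : smc (-x) = -smc x := by simp [smc]; ring

theorem smc_pos {x : ℝ} (hx : x ∈ Ioo 0 Real.pi) : 0 < smc x := by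
  have := strictMonoOn_of_deriv_pos (convex_Icc 0 Real.pi) (f := smc)
    (fun y _ => (hasDerivAt_smc y).continuousAt.continuousWithinAt)
    (fun y hy => by
      rw [interior_Icc] at hy
      rw [(hasDerivAt_smc y).deriv]
      exact mul_pos hy.1 (Real.sin_pos_of_mem_Ioo hy))
  have h := this ⟨le_rfl, Real.pi_pos.le⟩ ⟨hx.1.le, hx.2.le⟩ hx.1
  simpa [smc] using h

theorem mul_mem_Ioo_pi {s h : ℝ} (hs : s ∈ Ioc (0 : ℝ) 1) (hh : h ∈ Ioo 0 Real.pi) :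
    s * h ∈ Ioo 0 Real.pi :=
  ⟨mul_pos hs.1 hh.1, lt_of_le_of_lt (by nlinarith [hs.2, hh.1]) hh.2⟩

/-- If the elasticity `x f'(x) / f(x)` of a positive function decreases, then `f (s x) / f x`
increases. -/
theorem monotoneOn_div_of_antitoneOn_elasticity {f f' : ℝ → ℝ}
    (hf : ∀ x, HasDerivAt f (f' x) x) (hpos : ∀ x ∈ Ioo 0 Real.pi, 0 < f x)
    (hel : AntitoneOn (fun x => x * f' x / f x) (Ioo 0 Real.pi)) {s : ℝ} (hs : s ∈ Ioc (0 : ℝ) 1) :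
    MonotoneOn (fun x => f (s * x) / f x) (Ioo 0 Real.pi) := by
  have hd : ∀ x ∈ Ioo 0 Real.pi, HasDerivAt (fun x => f (s * x) / f x)
      ((f' (s * x) * s * f x - f (s * x) * f' x) / f x ^ 2) x := fun x hx => by
    have h1 : HasDerivAt (fun x => s * x) s x := by simpa using (hasDerivAt_id x).const_mul s
    exact ((hf (s * x)).comp x h1).fun_div (hf x) (hpos x hx).ne'
  refine monotoneOn_of_deriv_nonneg (convex_Ioo _ _)
    (fun x hx => (hd x hx).continuousAt.continuousWithinAt)
    (fun x hx => ((hd x (interior_subset hx)).differentiableAt.differentiableWithinAt)) ?_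
  intro x hx
  replace hx := interior_subset hx
  rw [(hd x hx).deriv]
  have hsx := mul_mem_Ioo_pi hs hx
  have h2 := hel hsx hx (by nlinarith [hs.2, hx.1])
  simp only at h2
  have p1 := hpos x hx
  have p2 := hpos _ hsx
  rw [div_le_div_iff₀ p1 p2] at h2
  refine div_nonneg ?_ (sq_nonneg _)
  have : x * (f' (s * x) * s * f x - f (s * x) * f' x) ≥ 0 := by linarith
  exact nonneg_of_mul_nonneg_right this hx.1

/-- This is the elasticity of `sin`; its derivative has the sign of `sin 2x - 2x`. -/
theorem antitoneOn_mul_cos_div_sin :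
    AntitoneOn (fun x => x * Real.cos x / Real.sin x) (Ioo 0 Real.pi) := by
  have hd : ∀ x ∈ Ioo 0 Real.pi, HasDerivAt (fun x => x * Real.cos x / Real.sin x)
      ((Real.sin x * Real.cos x - x) / Real.sin x ^ 2) x := fun x hx => by
    have hs := (Real.sin_pos_of_mem_Ioo hx).ne'
    refine (((hasDerivAt_id x).fun_mul (Real.hasDerivAt_cos x)).fun_div
      (Real.hasDerivAt_sin x) hs).congr_deriv ?_
    simp only [id]
    congr 1
    have := Real.sin_sq_add_cos_sq x
    linear_combination -x * this
  refine antitoneOn_of_deriv_nonpos (convex_Ioo _ _)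
    (fun x hx => (hd x hx).continuousAt.continuousWithinAt)
    (fun x hx => ((hd x (interior_subset hx)).differentiableAt.differentiableWithinAt)) ?_
  intro x hx
  replace hx := interior_subset hx
  rw [(hd x hx).deriv]
  refine div_nonpos_of_nonpos_of_nonneg ?_ (sq_nonneg _)
  have := Real.sin_le (x := 2 * x) (by linarith [hx.1])
  rw [Real.sin_two_mul] at this
  linarith

/-- The difference vanishes at `0` with its first derivative, and its second derivative is `4 sin x
· smc x ≥ 0`. It governs the elasticity of `smc`. -/
theorem two_mul_sin_sq_le {x : ℝ} (hx : x ∈ Icc 0 Real.pi) :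
    2 * Real.sin x ^ 2 ≤ x ^ 2 + x * Real.sin x * Real.cos x := by
  have d1 : ∀ x, HasDerivAt (fun x => x ^ 2 + x * Real.sin x * Real.cos x - 2 * Real.sin x ^ 2)
      (2 * x - 3 * (Real.sin x * Real.cos x) + x * (Real.cos x ^ 2 - Real.sin x ^ 2)) x :=
    fun x => by
    refine ((((hasDerivAt_id x).fun_pow 2).fun_add (((hasDerivAt_id x).fun_mul
      (Real.hasDerivAt_sin x)).fun_mul (Real.hasDerivAt_cos x))).fun_sub
        (((Real.hasDerivAt_sin x).fun_pow 2).const_mul 2)).congr_deriv ?_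
    simp only [id]
    push_cast
    ring
  have d2 : ∀ x, HasDerivAt (fun x => 2 * x - 3 * (Real.sin x * Real.cos x)
      + x * (Real.cos x ^ 2 - Real.sin x ^ 2)) (4 * Real.sin x * smc x) x := fun x => by
    refine ((((hasDerivAt_id x).const_mul 2).fun_sub (((Real.hasDerivAt_sin x).fun_mul
      (Real.hasDerivAt_cos x)).const_mul 3)).fun_add ((hasDerivAt_id x).fun_mul
        (((Real.hasDerivAt_cos x).fun_pow 2).fun_sub
          ((Real.hasDerivAt_sin x).fun_pow 2)))).congr_deriv ?_
    have := Real.sin_sq_add_cos_sq x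
    simp only [id, smc]
    push_cast
    linear_combination (-2) * this
  have h2 : ∀ x ∈ Icc 0 Real.pi, 0 ≤ 2 * x - 3 * (Real.sin x * Real.cos x)
      + x * (Real.cos x ^ 2 - Real.sin x ^ 2) := fun x hx =>
    nonneg_of_hasDerivAt_nonneg d2 (by simp) (fun y hy => mul_nonneg
      (mul_nonneg (by norm_num) (Real.sin_pos_of_mem_Ioo hy).le) (smc_pos hy).le) hx
  have := nonneg_of_hasDerivAt_nonneg d1 (by simp) (fun y hy => h2 y ⟨hy.1.le, hy.2.le⟩) hx
  linarith

theorem antitoneOn_sq_mul_sin_div_smc :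
    AntitoneOn (fun x => x * (x * Real.sin x) / smc x) (Ioo 0 Real.pi) := by
  have hd : ∀ x ∈ Ioo 0 Real.pi, HasDerivAt (fun x => x * (x * Real.sin x) / smc x)
      (x * (2 * Real.sin x ^ 2 - (x ^ 2 + x * Real.sin x * Real.cos x)) / smc x ^ 2) x :=
    fun x hx => by
    refine (((hasDerivAt_id x).fun_mul ((hasDerivAt_id x).fun_mul
      (Real.hasDerivAt_sin x))).fun_div (hasDerivAt_smc x) (smc_pos hx).ne').congr_deriv ?_
    have := Real.sin_sq_add_cos_sq x
    simp only [id, smc]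
    congr 1
    linear_combination -x ^ 3 * this
  refine antitoneOn_of_deriv_nonpos (convex_Ioo _ _)
    (fun x hx => (hd x hx).continuousAt.continuousWithinAt)
    (fun x hx => ((hd x (interior_subset hx)).differentiableAt.differentiableWithinAt)) ?_
  intro x hx
  replace hx := interior_subset hx
  rw [(hd x hx).deriv]
  refine div_nonpos_of_nonpos_of_nonneg (mul_nonpos_of_nonneg_of_nonpos hx.1.le ?_) (sq_nonneg _)
  linarith [two_mul_sin_sq_le ⟨hx.1.le, hx.2.le⟩]

theorem mul_sin_le_sin_mul {s h : ℝ} (hs : s ∈ Icc (0 : ℝ) 1) (hh : h ∈ Icc 0 Real.pi) :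
    s * Real.sin h ≤ Real.sin (s * h) := by
  have := strictConcaveOn_sin_Icc.concaveOn.2 hh ⟨le_rfl, Real.pi_pos.le⟩ hs.1
    (sub_nonneg.2 hs.2) (add_sub_cancel s 1)
  simpa using this

/-- Since `smc' = x sin x`, integrating `s sin x ≤ sin (s x)` gains two further powers of `s`. -/
theorem cube_mul_smc_le {s h : ℝ} (hs : s ∈ Icc (0 : ℝ) 1) (hh : h ∈ Icc 0 Real.pi) :
    s ^ 3 * smc h ≤ smc (s * h) := by
  have d : ∀ x, HasDerivAt (fun x => smc (s * x) - s ^ 3 * smc x)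
      (s ^ 2 * x * (Real.sin (s * x) - s * Real.sin x)) x := fun x => by
    have h1 : HasDerivAt (fun x => s * x) s x := by simpa using (hasDerivAt_id x).const_mul s
    refine (((hasDerivAt_smc (s * x)).comp x h1).fun_sub
      ((hasDerivAt_smc x).const_mul (s ^ 3))).congr_deriv ?_
    ring
  have := nonneg_of_hasDerivAt_nonneg d (by simp [smc]) (fun y hy => mul_nonneg
    (mul_nonneg (sq_nonneg _) hy.1.le)
    (sub_nonneg.2 (mul_sin_le_sin_mul hs ⟨hy.1.le, hy.2.le⟩))) hh
  linarith

/-- The power `τ_sⁿ(2h) ^ (2n+1)` of the distortion coefficient. -/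
noncomputable def distortion (n : ℕ) (s h : ℝ) : ℝ :=
  s * (Real.sin (s * h) / Real.sin h) ^ (2 * n - 1) * (smc (s * h) / smc h)

theorem distortion_abs (n : ℕ) (s h : ℝ) : distortion n s |h| = distortion n s h := by
  rcases abs_choice h with e | e <;> rw [e]
  simp only [distortion, mul_neg, Real.sin_neg, smc_neg, neg_div_neg_eq]

theorem distortion_mono (n : ℕ) {s h₁ h₂ : ℝ} (hs : s ∈ Ioc (0 : ℝ) 1) (h1 : h₁ ∈ Ioo 0 Real.pi)
    (h2 : h₂ ∈ Ioo 0 Real.pi) (h : h₁ ≤ h₂) : distortion n s h₁ ≤ distortion n s h₂ := by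
  have a := monotoneOn_div_of_antitoneOn_elasticity Real.hasDerivAt_sin
    (fun x hx => Real.sin_pos_of_mem_Ioo hx) antitoneOn_mul_cos_div_sin hs h1 h2 h
  have b := monotoneOn_div_of_antitoneOn_elasticity hasDerivAt_smc
    (fun x hx => smc_pos hx) antitoneOn_sq_mul_sin_div_smc hs h1 h2 h
  have a0 : 0 ≤ Real.sin (s * h₁) / Real.sin h₁ := div_nonneg
    (Real.sin_pos_of_mem_Ioo (mul_mem_Ioo_pi hs h1)).le (Real.sin_pos_of_mem_Ioo h1).le
  have b0 : 0 ≤ smc (s * h₁) / smc h₁ := div_nonneg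
    (smc_pos (mul_mem_Ioo_pi hs h1)).le (smc_pos h1).le
  simp only at a b
  have hs0 := hs.1.le
  unfold distortion
  gcongr
  exact mul_nonneg hs0 (pow_nonneg (a0.trans a) _)

theorem pow_le_distortion {n : ℕ} (hn : 1 ≤ n) {s h : ℝ} (hs : s ∈ Ioc (0 : ℝ) 1)
    (hh : h ∈ Ioo 0 Real.pi) : s ^ (2 * n + 3) ≤ distortion n s h := by
  have a : s ≤ Real.sin (s * h) / Real.sin h := by
    rw [le_div_iff₀ (Real.sin_pos_of_mem_Ioo hh)]
    exact mul_sin_le_sin_mul ⟨hs.1.le, hs.2⟩ ⟨hh.1.le, hh.2.le⟩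
  have b : s ^ 3 ≤ smc (s * h) / smc h := by
    rw [le_div_iff₀ (smc_pos hh)]
    exact cube_mul_smc_le ⟨hs.1.le, hs.2⟩ ⟨hh.1.le, hh.2.le⟩
  have hs0 := hs.1.le
  calc s ^ (2 * n + 3) = s * s ^ (2 * n - 1) * s ^ 3 := by
        rw [← pow_succ', ← pow_add]; congr 1; omega
    _ ≤ _ := by
      unfold distortion
      gcongr
      exact mul_nonneg hs0 (pow_nonneg (hs0.trans a) _)

theorem rpow_div_pow {x : ℝ} (hx : 0 ≤ x) (m : ℝ) {d : ℕ} (hd : d ≠ 0) :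
    (x ^ (m / d)) ^ d = x ^ m := by
  rw [← Real.rpow_natCast, ← Real.rpow_mul hx, div_mul_cancel₀]
  exact_mod_cast hd

theorem tau_zero_pow (n : ℕ) {s : ℝ} (hs : 0 ≤ s) :
    tau n s 0 ^ (2 * n + 1) = ENNReal.ofReal (s ^ (2 * n + 3)) := by
  have h2 : (0 : ℝ) ≠ 2 * Real.pi := by positivity
  rw [tau, if_neg h2, if_pos rfl, ← ENNReal.ofReal_pow (Real.rpow_nonneg hs _)]
  have := rpow_div_pow hs (2 * (n : ℝ) + 3) (d := 2 * n + 1) (by omega)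
  push_cast at this
  rw [this, ← Real.rpow_natCast]
  push_cast
  rfl

theorem tau_pow {n : ℕ} (hn : 1 ≤ n) {s θ : ℝ} (hs : s ∈ Ioc (0 : ℝ) 1)
    (hθ : θ ∈ Ioo 0 (2 * Real.pi)) :
    tau n s θ ^ (2 * n + 1) = ENNReal.ofReal (distortion n s (θ / 2)) := by
  have hh : θ / 2 ∈ Ioo 0 Real.pi := ⟨by linarith [hθ.1], by linarith [hθ.2]⟩
  have a0 : 0 ≤ Real.sin (s * (θ / 2)) / Real.sin (θ / 2) := div_nonneg
    (Real.sin_pos_of_mem_Ioo (mul_mem_Ioo_pi hs hh)).le (Real.sin_pos_of_mem_Ioo hh).le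
  have b0 : 0 ≤ smc (s * (θ / 2)) / smc (θ / 2) := div_nonneg
    (smc_pos (mul_mem_Ioo_pi hs hh)).le (smc_pos hh).le
  have e : θ * s / 2 = s * (θ / 2) := by ring
  rw [tau, if_neg hθ.2.ne, if_neg hθ.1.ne', e]
  change ENNReal.ofReal (_ * _ * (smc (s * (θ / 2)) / smc (θ / 2)) ^ _) ^ _ = _
  have hs0 := hs.1.le
  rw [← ENNReal.ofReal_pow (by positivity), mul_pow, mul_pow]
  have r1 := rpow_div_pow hs0 1 (d := 2 * n + 1) (by omega)
  have r2 := rpow_div_pow a0 (2 * (n : ℝ) - 1) (d := 2 * n + 1) (by omega)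
  have r3 := rpow_div_pow b0 1 (d := 2 * n + 1) (by omega)
  push_cast at r1 r2 r3
  rw [r1, r2, r3, Real.rpow_one, Real.rpow_one, distortion, ← Real.rpow_natCast _ (2 * n - 1)]
  congr 4
  rw [Nat.cast_sub (by omega)]
  push_cast
  rfl

theorem ofReal_pow_le_tau_pow {n : ℕ} (hn : 1 ≤ n) {s T : ℝ} (hs : s ∈ Ioc (0 : ℝ) 1)
    (hT : T ∈ Ico 0 (2 * Real.pi)) :
    ENNReal.ofReal (s ^ (2 * n + 3)) ≤ tau n s T ^ (2 * n + 1) := by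
  rcases hT.1.eq_or_lt with rfl | h0
  · rw [tau_zero_pow n hs.1.le]
  · rw [tau_pow hn hs ⟨h0, hT.2⟩]
    exact ENNReal.ofReal_le_ofReal
      (pow_le_distortion hn hs ⟨by linarith, by linarith [hT.2]⟩)

theorem tau_pow_le {n : ℕ} (hn : 1 ≤ n) {s T θ : ℝ} (hs : s ∈ Ioc (0 : ℝ) 1) (hT : 0 ≤ T)
    (hTθ : T ≤ |θ|) (hθ : θ ≠ 0) (hθ' : |θ| < 2 * Real.pi) :
    tau n s T ^ (2 * n + 1) ≤ ENNReal.ofReal (distortion n s (θ / 2)) := by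
  have e : distortion n s (θ / 2) = distortion n s (|θ| / 2) := by
    rw [← distortion_abs, abs_div, abs_two]
  have h2 : |θ| / 2 ∈ Ioo 0 Real.pi := ⟨by positivity, by linarith⟩
  rw [e]
  rcases hT.eq_or_lt with rfl | h0
  -- At `T = 0` the coefficient is `s^(2n+3)`, so the universal lower bound replaces monotonicity.
  · rw [tau_zero_pow n hs.1.le]
    exact ENNReal.ofReal_le_ofReal (pow_le_distortion hn hs h2)
  · rw [tau_pow hn hs ⟨h0, by linarith⟩]
    exact ENNReal.ofReal_le_ofReal
      (distortion_mono n hs ⟨by linarith, by linarith⟩ h2 (by linarith))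

theorem tau_ne_top (n : ℕ) (s : ℝ) {T : ℝ} (hT : T ≠ 2 * Real.pi) : tau n s T ≠ ⊤ := by
  rw [tau, if_neg hT]
  split_ifs <;> exact ENNReal.ofReal_ne_top

theorem tau_zero_left (n : ℕ) {T : ℝ} (hT : T ≠ 2 * Real.pi) : tau n 0 T = 0 := by
  have h1 : (0 : ℝ) < 2 * (n : ℝ) + 1 := by positivity
  rw [tau, if_neg hT]
  split_ifs
  · rw [Real.zero_rpow (by positivity), ENNReal.ofReal_zero]
  · rw [Real.zero_rpow (by positivity), zero_mul, zero_mul, ENNReal.ofReal_zero]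

/-! ### The angle as a function of `t / |ζ|²` -/

/-- The ratio `t / |ζ|²` along `geod`, as a function of the angle. -/
noncomputable def rho (φ : ℝ) : ℝ := (φ - Real.sin φ) / (1 - Real.cos φ)

/-- The derivative of `rho`. -/
noncomputable def drho (φ : ℝ) : ℝ :=
  (2 * (1 - Real.cos φ) - φ * Real.sin φ) / (1 - Real.cos φ) ^ 2

theorem rho_neg (φ : ℝ) : rho (-φ) = -rho φ := by
  simp only [rho, Real.sin_neg, Real.cos_neg, ← neg_div]
  congr 1; ring

theorem drho_neg (φ : ℝ) : drho (-φ) = drho φ := by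
  simp [drho]

theorem one_sub_cos_pos {φ : ℝ} (h0 : φ ≠ 0) (h : |φ| < 2 * Real.pi) : 0 < 1 - Real.cos φ := by
  rw [abs_lt] at h
  have := (Real.cos_eq_one_iff_of_lt_of_lt h.1 h.2).not.2 h0
  have := lt_of_le_of_ne (Real.cos_le_one φ) this
  linarith

theorem hasDerivAt_rho {φ : ℝ} (h0 : φ ≠ 0) (h : |φ| < 2 * Real.pi) :
    HasDerivAt rho (drho φ) φ := by
  refine (((hasDerivAt_id φ).fun_sub (Real.hasDerivAt_sin φ)).fun_div
    ((Real.hasDerivAt_cos φ).const_sub 1) (one_sub_cos_pos h0 h).ne').congr_deriv ?_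
  simp only [id, drho]
  congr 1
  have := Real.sin_sq_add_cos_sq φ
  linear_combination this

theorem drho_eq {h : ℝ} : drho (2 * h) = smc h / Real.sin h ^ 3 := by
  have e : 1 - Real.cos (2 * h) = 2 * Real.sin h ^ 2 := by
    rw [Real.cos_two_mul, Real.cos_sq']; ring
  rw [drho, e, Real.sin_two_mul, smc]
  -- Both quotients are then `0` by the convention for division by zero.
  by_cases hs : Real.sin h = 0
  · simp [hs]
  field_simp

theorem drho_pos {φ : ℝ} (h0 : φ ≠ 0) (h : |φ| < 2 * Real.pi) : 0 < drho φ := by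
  wlog hp : 0 < φ generalizing φ
  · rw [← drho_neg]
    exact this (neg_ne_zero.2 h0) (by rwa [abs_neg])
      (neg_pos.2 (lt_of_le_of_ne (not_lt.1 hp) h0))
  rw [abs_of_pos hp] at h
  have hh : φ / 2 ∈ Ioo 0 Real.pi := ⟨by linarith, by linarith⟩
  have : φ = 2 * (φ / 2) := by ring
  rw [this, drho_eq]
  have := smc_pos hh
  have := Real.sin_pos_of_mem_Ioo hh
  positivity

theorem rho_pos {φ : ℝ} (h0 : 0 < φ) (h : φ < 2 * Real.pi) : 0 < rho φ :=
  div_pos (sub_pos.2 (Real.sin_lt h0))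
    (one_sub_cos_pos h0.ne' (by rwa [abs_of_pos h0]))

/-- `rho` is strictly increasing and positive on `(0, 2π)`, and odd, so its two branches do not
meet. -/
theorem injOn_rho : InjOn rho {φ | φ ≠ 0 ∧ |φ| < 2 * Real.pi} := by
  have hm : StrictMonoOn rho (Ioo 0 (2 * Real.pi)) := by
    have hd : ∀ x ∈ Ioo 0 (2 * Real.pi), x ≠ 0 ∧ |x| < 2 * Real.pi := fun x hx =>
      ⟨hx.1.ne', by rw [abs_of_pos hx.1]; exact hx.2⟩
    refine strictMonoOn_of_deriv_pos (convex_Ioo _ _) (fun x hx =>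
      (hasDerivAt_rho (hd x hx).1 (hd x hx).2).continuousAt.continuousWithinAt) (fun x hx => ?_)
    obtain ⟨h1, h2⟩ := hd x (interior_subset hx)
    rw [(hasDerivAt_rho h1 h2).deriv]
    exact drho_pos h1 h2
  rintro x ⟨hx0, hx⟩ y ⟨hy0, hy⟩ hxy
  rw [abs_lt] at hx hy
  rcases lt_or_gt_of_ne hx0 with hx0 | hx0 <;> rcases lt_or_gt_of_ne hy0 with hy0 | hy0
  · have := hm.injOn (x₁ := -x) (x₂ := -y) ⟨by linarith, by linarith⟩ ⟨by linarith, by linarith⟩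
      (by rw [rho_neg, rho_neg, hxy])
    linarith
  · have h1 := rho_pos (φ := -x) (by linarith) (by linarith)
    have h2 := rho_pos hy0 hy.2
    rw [rho_neg] at h1
    linarith
  · have h1 := rho_pos (φ := -y) (by linarith) (by linarith)
    have h2 := rho_pos hx0 hx.2
    rw [rho_neg] at h1
    linarith
  · exact hm.injOn ⟨hx0, hx.2⟩ ⟨hy0, hy.2⟩ hxy

theorem exists_rho_eq_of_pos {t : ℝ} (ht : 0 < t) : ∃ φ ∈ Ioo 0 (2 * Real.pi), rho φ = t := by
  -- Clearing the denominator of `rho φ = t` gives a function continuous on all of `[0, 2π]`, fit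
  -- for the intermediate value theorem.
  set F : ℝ → ℝ := fun φ => φ - Real.sin φ - t * (1 - Real.cos φ) with hF
  have hFc : Continuous F := by fun_prop
  -- Near `0`, `φ - sin φ ≤ φ³/4` and `1 - cos φ ≥ φ²/5`, so `φ₁ ≤ t/2` makes `F φ₁ ≤ 0`; the bound
  -- `1` keeps `φ₁` below `π`.
  set φ₁ := min 1 (t / 2) with hφ
  have h1 : 0 < φ₁ := lt_min one_pos (by positivity)
  have h1' : φ₁ ≤ 1 := min_le_left _ _
  have h1'' : φ₁ ≤ t / 2 := min_le_right _ _
  have hpi := Real.pi_gt_three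
  have neg : F φ₁ ≤ 0 := by
    have a := Real.sin_gt_sub_cube h1
    have b := Real.cos_le_one_sub_mul_cos_sq (x := φ₁) (by rw [abs_of_pos h1]; linarith)
    have c : 1 / 5 ≤ 2 / Real.pi ^ 2 := by
      rw [div_le_div_iff₀ (by norm_num) (by positivity)]
      nlinarith [Real.pi_lt_d2]
    have d : 1 / 5 * φ₁ ^ 2 ≤ 1 - Real.cos φ₁ := by nlinarith [sq_nonneg φ₁]
    have e : φ₁ - Real.sin φ₁ ≤ φ₁ ^ 3 / 4 := by linarith [pow_pos h1 3]
    have f : φ₁ ^ 3 / 4 ≤ t * (1 / 5 * φ₁ ^ 2) := by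
      have : 0 ≤ φ₁ ^ 2 * (t / 2 - φ₁) := mul_nonneg (sq_nonneg _) (by linarith)
      nlinarith [mul_pos ht (pow_pos h1 2)]
    have g := mul_le_mul_of_nonneg_left d ht.le
    simp only [hF]
    linarith
  have pos : 0 ≤ F (2 * Real.pi) := by simp [hF, Real.pi_pos.le]
  obtain ⟨φ, hm, hz⟩ := intermediate_value_Icc (by linarith : φ₁ ≤ 2 * Real.pi)
    hFc.continuousOn ⟨neg, pos⟩
  have hφ0 : 0 < φ := h1.trans_le hm.1
  have hφ2 : φ < 2 * Real.pi := by
    refine lt_of_le_of_ne hm.2 ?_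
    rintro rfl
    simp [hF, Real.pi_ne_zero] at hz
  refine ⟨φ, ⟨hφ0, hφ2⟩, ?_⟩
  have := one_sub_cos_pos hφ0.ne' (by rwa [abs_of_pos hφ0])
  rw [rho, div_eq_iff this.ne']
  simp only [hF] at hz
  linarith

theorem exists_rho_eq {t : ℝ} (ht : t ≠ 0) : ∃ φ, (φ ≠ 0 ∧ |φ| < 2 * Real.pi) ∧ rho φ = t := by
  rcases lt_or_gt_of_ne ht with h | h
  · obtain ⟨φ, h1, h2⟩ := exists_rho_eq_of_pos (neg_pos.2 h)
    exact ⟨-φ, ⟨neg_ne_zero.2 h1.1.ne', by rw [abs_neg, abs_of_pos h1.1]; exact h1.2⟩,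
      by rw [rho_neg, h2, neg_neg]⟩
  · obtain ⟨φ, h1, h2⟩ := exists_rho_eq_of_pos h
    exact ⟨φ, ⟨h1.1.ne', by rw [abs_of_pos h1.1]; exact h1.2⟩, h2⟩

/-! ### Integration in the coordinates `(χ, θ)` -/

theorem measurable_eNorm : Measurable (eNorm : (Fin n → ℂ) → ℝ) := by
  unfold eNorm
  fun_prop

theorem eNorm_eq_zero {χ : Fin n → ℂ} : eNorm χ = 0 ↔ χ = 0 := by
  rw [← sq_eq_zero_iff, eNorm_sq, Finset.sum_eq_zero_iff_of_nonneg (fun _ _ => by positivity)]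
  simp [funext_iff]

theorem measurable_rho : Measurable rho := by
  unfold rho
  fun_prop

theorem measurable_drho : Measurable drho := by
  unfold drho
  fun_prop

/-- The angles `θ` for which the curve `geod χ θ` has its endpoint off the vertical axis. -/
def angles : Set ℝ := {θ | θ ≠ 0 ∧ |θ| < 2 * Real.pi}

theorem measurableSet_angles : MeasurableSet angles := by
  have h1 : MeasurableSet {θ : ℝ | θ ≠ 0} := (measurableSet_singleton 0).compl
  have h2 : MeasurableSet {θ : ℝ | |θ| < 2 * Real.pi} :=
    measurableSet_lt (by fun_prop) measurable_const
  exact h1.inter h2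

theorem mul_mem_angles {θ s : ℝ} (hs : s ∈ Ioc (0 : ℝ) 1) (hθ : θ ∈ angles) : θ * s ∈ angles := by
  refine ⟨mul_ne_zero hθ.1 hs.1.ne', ?_⟩
  rw [abs_mul, abs_of_pos hs.1]
  nlinarith [hθ.2, hs.2, abs_nonneg θ, hs.1]

theorem kap_ne_zero {θ s : ℝ} (hs : s ∈ Ioc (0 : ℝ) 1) (hθ : θ ∈ angles) : kap θ s ≠ 0 := by
  have h := mul_mem_angles hs hθ
  have h1 := one_sub_cos_pos h.1 h.2
  have h2 : 0 < ‖kap θ s‖ ^ 2 := by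
    rw [normSq_kap]
    have := hθ.1
    positivity
  intro h3
  simp [h3] at h2

theorem geod_eq_rho {θ s : ℝ} (hs : s ∈ Ioc (0 : ℝ) 1) (hθ : θ ∈ angles) (χ : Fin n → ℂ) :
    geod χ θ s = (kap θ s • χ, eNorm (kap θ s • χ) ^ 2 * rho (θ * s)) := by
  have h := mul_mem_angles hs hθ
  have h1 := one_sub_cos_pos h.1 h.2
  have h2 := hθ.1
  rw [geod_eq hθ.1, eNorm_smul, mul_pow, normSq_kap, rho]
  congr 1
  field_simp

theorem measurePreserving_smul_of_norm_eq_one {z : ℂ} (hz : ‖z‖ = 1) :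
    MeasurePreserving (fun χ : Fin n → ℂ => z • χ) := by
  have h := (rotation ⟨z, mem_sphere_zero_iff_norm.2 hz⟩).measurePreserving
  exact volume_preserving_pi (fun _ : Fin n => h)

/-- Split `z` into its modulus, a real dilation in dimension `2n`, and a phase, which preserves the
measure. -/
theorem lintegral_smul_vec {z : ℂ} (hz : z ≠ 0) {g : (Fin n → ℂ) → ℝ≥0∞} (hg : Measurable g) :
    ∫⁻ ζ, g ζ = ENNReal.ofReal (‖z‖ ^ (2 * n)) * ∫⁻ χ, g (z • χ) := by
  have hz0 : 0 < ‖z‖ := norm_pos_iff.2 hz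
  have hu : ‖z / (‖z‖ : ℂ)‖ = 1 := by
    rw [norm_div, Complex.norm_real, norm_norm, div_self hz0.ne']
  have hr := Measure.map_addHaar_smul (volume : Measure (Fin n → ℂ)) hz0.ne'
  have hfin : Module.finrank ℝ (Fin n → ℂ) = 2 * n := by
    rw [Module.finrank_pi_fintype]
    simp [Complex.finrank_real_complex, mul_comm]
  rw [hfin, abs_of_pos (by positivity), ENNReal.ofReal_inv_of_pos (by positivity)] at hr
  have h1 : ∫⁻ χ, g (z • χ) = ∫⁻ χ, g ((z / (‖z‖ : ℂ)) • χ) ∂(Measure.map (‖z‖ • ·) volume) := by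
    have hg' : Measurable fun χ : Fin n → ℂ => g ((z / (‖z‖ : ℂ)) • χ) :=
      hg.comp (measurable_const_smul _)
    rw [lintegral_map hg' (measurable_const_smul _)]
    refine lintegral_congr fun χ => congrArg g ?_
    have hzc : (‖z‖ : ℂ) ≠ 0 := by exact_mod_cast hz0.ne'
    funext j
    simp only [Pi.smul_apply, smul_eq_mul, Complex.real_smul]
    field_simp
  rw [h1, hr, lintegral_smul_measure, (measurePreserving_smul_of_norm_eq_one hu).lintegral_comp hg,
    smul_eq_mul, ← mul_assoc, ENNReal.mul_inv_cancel, one_mul]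
  · exact (ENNReal.ofReal_pos.2 (by positivity)).ne'
  · exact ENNReal.ofReal_ne_top

/-- The Jacobian of `(χ, θ) ↦ geod χ θ s`, up to the factor `|χ|²`. -/
noncomputable def jac (n : ℕ) (s θ : ℝ) : ℝ := s * drho (θ * s) * ‖kap θ s‖ ^ (2 * n + 2)

theorem jac_nonneg {s θ : ℝ} (hs : s ∈ Ioc (0 : ℝ) 1) (hθ : θ ∈ angles) : 0 ≤ jac n s θ := by
  have h := mul_mem_angles hs hθ
  have := drho_pos h.1 h.2
  have := hs.1
  unfold jac
  positivity

/-- Substitute `t = |ζ|² rho(θs)` for fixed `ζ`, swap the integrals, then substitute `ζ = kap θ s •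
χ` for fixed `θ`. The latter yields `‖kap‖^(2n)`, and `|ζ|² = ‖kap‖² |χ|²` the remaining two powers.
-/
theorem lintegral_jac_eq {s : ℝ} (hs : s ∈ Ioc (0 : ℝ) 1) {A : Set (H n)} (hA : MeasurableSet A) :
    ∫⁻ θ in angles, ENNReal.ofReal (jac n s θ) *
        ∫⁻ χ, ENNReal.ofReal (eNorm χ ^ 2) * A.indicator 1 (geod χ θ s) =
      ∫⁻ ζ, ∫⁻ t in (fun θ => eNorm ζ ^ 2 * rho (θ * s)) '' angles, A.indicator 1 (ζ, t) := by
  have hm : Measurable fun p : (Fin n → ℂ) × ℝ => ENNReal.ofReal (eNorm p.1 ^ 2) *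
      A.indicator (1 : H n → ℝ≥0∞) (p.1, eNorm p.1 ^ 2 * rho (p.2 * s)) := by
    have h1 : Measurable fun p : (Fin n → ℂ) × ℝ => eNorm p.1 ^ 2 :=
      (measurable_eNorm.comp measurable_fst).pow_const 2
    have h2 : Measurable fun p : (Fin n → ℂ) × ℝ => rho (p.2 * s) :=
      measurable_rho.comp (measurable_snd.mul_const s)
    exact h1.ennreal_ofReal.mul ((measurable_one.indicator hA).comp
      (measurable_fst.prodMk (h1.mul h2)))
  have hd : Measurable fun θ : ℝ => s * drho (θ * s) :=
    (measurable_drho.comp (measurable_id.mul_const s)).const_mul s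
  have right : ∀ ζ : Fin n → ℂ,
      ∫⁻ t in (fun θ => eNorm ζ ^ 2 * rho (θ * s)) '' angles, A.indicator (1 : H n → ℝ≥0∞) (ζ, t)
      = ∫⁻ θ in angles, ENNReal.ofReal (s * drho (θ * s)) * (ENNReal.ofReal (eNorm ζ ^ 2) *
        A.indicator 1 (ζ, eNorm ζ ^ 2 * rho (θ * s))) := by
    intro ζ
    by_cases hζ : eNorm ζ = 0
    · have : volume ((fun θ => eNorm ζ ^ 2 * rho (θ * s)) '' angles) = 0 := by
        refine measure_mono_null (t := {0}) ?_ (by simp)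
        rintro _ ⟨θ, _, rfl⟩
        simp [hζ]
      rw [Measure.restrict_eq_zero.2 this]
      simp [hζ]
    · have h0 : 0 < eNorm ζ ^ 2 := by positivity
      rw [lintegral_image_eq_lintegral_abs_deriv_mul (f' := fun θ => eNorm ζ ^ 2 * (drho (θ * s) * s))
        measurableSet_angles]
      · refine setLIntegral_congr_fun measurableSet_angles fun θ hθ => ?_
        have h := mul_mem_angles hs hθ
        have hp := drho_pos h.1 h.2
        have hs0 := hs.1
        rw [abs_of_pos (by positivity), ← mul_assoc (ENNReal.ofReal _) (ENNReal.ofReal _),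
          ← ENNReal.ofReal_mul (by positivity)]
        congr 2
        ring
      · intro θ hθ
        have h := mul_mem_angles hs hθ
        have h1 : HasDerivAt (fun θ => θ * s) s θ := by simpa using (hasDerivAt_id θ).mul_const s
        exact (((hasDerivAt_rho h.1 h.2).comp θ h1).const_mul _).hasDerivWithinAt
      · intro θ hθ θ' hθ' e
        have := injOn_rho (mul_mem_angles hs hθ) (mul_mem_angles hs hθ')
          (mul_left_cancel₀ h0.ne' e)
        exact mul_right_cancel₀ hs.1.ne' this
  simp only [right]
  rw [lintegral_lintegral_swap]
  · refine setLIntegral_congr_fun measurableSet_angles fun θ hθ => ?_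
    have h := mul_mem_angles hs hθ
    have hp := drho_pos h.1 h.2
    have hs0 := hs.1
    have hmθ : Measurable fun ζ : Fin n → ℂ => ENNReal.ofReal (eNorm ζ ^ 2) *
        A.indicator (1 : H n → ℝ≥0∞) (ζ, eNorm ζ ^ 2 * rho (θ * s)) := by
      have h1 : Measurable fun ζ : Fin n → ℂ => eNorm ζ ^ 2 := measurable_eNorm.pow_const 2
      exact h1.ennreal_ofReal.mul ((measurable_one.indicator hA).comp
        (measurable_id.prodMk (h1.mul_const _)))
    have hj : ENNReal.ofReal (jac n s θ) = ENNReal.ofReal (s * drho (θ * s)) *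
        (ENNReal.ofReal (‖kap θ s‖ ^ (2 * n)) * ENNReal.ofReal (‖kap θ s‖ ^ 2)) := by
      have h1 : 0 ≤ s * drho (θ * s) := by positivity
      have h2 : 0 ≤ ‖kap θ s‖ ^ (2 * n) := by positivity
      rw [jac, pow_add, ENNReal.ofReal_mul h1, ENNReal.ofReal_mul h2]
    have hi : ∀ χ : Fin n → ℂ, ENNReal.ofReal (eNorm (kap θ s • χ) ^ 2) *
          A.indicator (1 : H n → ℝ≥0∞) (kap θ s • χ, eNorm (kap θ s • χ) ^ 2 * rho (θ * s)) =
        ENNReal.ofReal (‖kap θ s‖ ^ 2) *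
          (ENNReal.ofReal (eNorm χ ^ 2) * A.indicator (1 : H n → ℝ≥0∞) (geod χ θ s)) := fun χ => by
      have h1 : 0 ≤ ‖kap θ s‖ ^ 2 := by positivity
      rw [← geod_eq_rho hs hθ, eNorm_smul, mul_pow, ENNReal.ofReal_mul h1, mul_assoc]
    rw [lintegral_const_mul _ hmθ, lintegral_smul_vec (kap_ne_zero hs hθ) hmθ, hj,
      lintegral_congr hi, lintegral_const_mul' _ _ ENNReal.ofReal_ne_top, mul_assoc, mul_assoc]
  · exact ((hd.comp measurable_snd).ennreal_ofReal.mul hm).aemeasurable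

theorem volume_eq_lintegral_lintegral {A : Set (H n)} (hA : MeasurableSet A) :
    volume A = ∫⁻ ζ, ∫⁻ t, A.indicator 1 (ζ, t) := by
  rw [Measure.volume_eq_prod, Measure.prod_apply hA]
  refine lintegral_congr fun ζ => ?_
  rw [← lintegral_indicator_one (measurable_prodMk_left hA)]
  rfl

theorem lintegral_jac_le {s : ℝ} (hs : s ∈ Ioc (0 : ℝ) 1) {A : Set (H n)} (hA : MeasurableSet A) :
    ∫⁻ θ in angles, ENNReal.ofReal (jac n s θ) *
        ∫⁻ χ, ENNReal.ofReal (eNorm χ ^ 2) * A.indicator 1 (geod χ θ s) ≤ volume A := by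
  rw [lintegral_jac_eq hs hA, volume_eq_lintegral_lintegral hA]
  exact lintegral_mono fun ζ => setLIntegral_le_lintegral _ _

/-- At time `1` the range of `θ ↦ |ζ|² rho θ` contains every `t ≠ 0` as soon as `ζ ≠ 0`, and `n ≥ 1`
makes `ζ = 0` negligible. -/
theorem volume_eq_lintegral_jac (hn : 1 ≤ n) {A : Set (H n)} (hA : MeasurableSet A) :
    volume A = ∫⁻ θ in angles, ENNReal.ofReal (jac n 1 θ) *
        ∫⁻ χ, ENNReal.ofReal (eNorm χ ^ 2) * A.indicator 1 (geod χ θ 1) := by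
  rw [lintegral_jac_eq ⟨one_pos, le_rfl⟩ hA, volume_eq_lintegral_lintegral hA]
  have : Nonempty (Fin n) := ⟨⟨0, hn⟩⟩
  have hae : ∀ᵐ ζ : Fin n → ℂ, ζ ≠ 0 := by
    rw [ae_iff]
    simp
  refine lintegral_congr_ae ?_
  filter_upwards [hae] with ζ hζ
  have h0 : eNorm ζ ^ 2 ≠ 0 := pow_ne_zero _ (eNorm_eq_zero.not.2 hζ)
  rw [Measure.restrict_eq_self_of_ae_mem]
  have : ∀ᵐ t : ℝ, t ≠ 0 := by
    rw [ae_iff]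
    simp
  filter_upwards [this] with t ht
  obtain ⟨φ, hφ, e⟩ := exists_rho_eq (t := t / eNorm ζ ^ 2) (div_ne_zero ht h0)
  refine ⟨φ, hφ, ?_⟩
  simp only [mul_one, e]
  exact mul_div_cancel₀ _ h0

theorem measurePreserving_mul_left (x : H n) : MeasurePreserving (mul x) := by
  have h1 : Measurable fun p : H n => 2 * (∑ j, x.1 j * (starRingEnd ℂ) (p.1 j)).im := by
    have : (fun p : H n => 2 * (∑ j, x.1 j * (starRingEnd ℂ) (p.1 j)).im)
        = fun p : H n => (mul x p).2 - x.2 - p.2 := by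
      funext p; simp only [mul]; ring
    rw [this]
    exact ((measurable_snd.comp (continuous_mul_left x).measurable).sub_const _).sub measurable_snd
  refine MeasurePreserving.skew_product (f := fun ζ => x.1 + ζ)
    (g := fun ζ t => x.2 + t + 2 * (∑ j, x.1 j * (starRingEnd ℂ) (ζ j)).im)
    (measurePreserving_add_left volume x.1) ?_ (Filter.Eventually.of_forall fun ζ => ?_)
  · exact ((measurable_snd.const_add x.2)).add h1
  · have : (fun t => x.2 + t + 2 * (∑ j, x.1 j * (starRingEnd ℂ) (ζ j)).im)
        = fun t => (x.2 + 2 * (∑ j, x.1 j * (starRingEnd ℂ) (ζ j)).im) + t := by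
      funext t; ring
    rw [this]
    exact (measurePreserving_add_left volume _).map_eq

/-- With `h = θ/2`, both densities are `s · smc(sh) · sin(sh)^(2n-1)` times `(4/θ²)^(n+1)`, and the
last factor does not depend on `s`. -/
theorem jac_eq (hn : 1 ≤ n) {s θ : ℝ} (hs : s ∈ Ioc (0 : ℝ) 1) (hθ : θ ∈ angles) :
    jac n s θ = distortion n s (θ / 2) * jac n 1 θ := by
  have sin_ne : ∀ φ ∈ angles, Real.sin (φ / 2) ≠ 0 := fun φ hφ h => by
    have := one_sub_cos_pos hφ.1 hφ.2
    have e : φ = 2 * (φ / 2) := by ring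
    rw [e, Real.cos_two_mul, Real.cos_sq', h] at this
    norm_num at this
  have smc_ne : smc (θ / 2) ≠ 0 := fun h => by
    have := drho_pos hθ.1 hθ.2
    have e : θ = 2 * (θ / 2) := by ring
    rw [e, drho_eq, h] at this
    norm_num at this
  have key : ∀ s, s ∈ Ioc (0 : ℝ) 1 → jac n s θ
      = s * smc (s * (θ / 2)) * Real.sin (s * (θ / 2)) ^ (2 * n - 1) * (4 / θ ^ 2) ^ (n + 1) := by
    intro s hs
    have hsin := sin_ne _ (mul_mem_angles hs hθ)
    have e : θ * s = 2 * (s * (θ / 2)) := by ring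
    have e' : θ * s / 2 = s * (θ / 2) := by ring
    rw [e'] at hsin
    have hθ0 := hθ.1
    have hk : ‖kap θ s‖ ^ 2 = Real.sin (s * (θ / 2)) ^ 2 * (4 / θ ^ 2) := by
      rw [normSq_kap, e, Real.cos_two_mul, Real.cos_sq']
      field_simp
      ring
    have h2 : 2 * n + 2 = 2 * (n + 1) := by ring
    rw [jac, h2, pow_mul, hk, mul_pow, ← pow_mul, e, drho_eq]
    have h3 : 2 * (n + 1) = (2 * n - 1) + 3 := by omega
    rw [h3, pow_add]
    generalize s * (θ / 2) = φ at hsin ⊢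
    field_simp
  rw [key s hs, key 1 ⟨one_pos, le_rfl⟩, distortion]
  have hsin := pow_ne_zero (2 * n - 1) (sin_ne θ hθ)
  rw [one_mul, one_mul]
  generalize s * (θ / 2) = φ
  rw [div_pow (Real.sin φ)]
  generalize Real.sin (θ / 2) ^ (2 * n - 1) = q at hsin ⊢
  field_simp

/-! ### `Theta` as an essential infimum of angles -/

theorem Theta_nonneg (A B : Set (H n)) : 0 ≤ Theta A B := by
  refine Real.sSup_nonneg ?_
  rintro _ ⟨A₀, B₀, -, -, -, -, -, -, rfl⟩
  refine Real.sInf_nonneg ?_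
  rintro _ ⟨_, _, _, _, _, _, _, _, rfl⟩
  exact abs_nonneg _

/-- Some competitor `B₀` in the supremum has all its angles above `q`, so the set lies in the null
set `E \ B₀`; a nonempty `A₀ ⊆ {x}` must contain `x`. -/
theorem volume_angle_le_eq_zero (x : H n) {E : Set (H n)} (hE : E.Nonempty) {q : ℝ}
    (hq : q < Theta {x} E) :
    volume {y ∈ E | ∃ (χ : Fin n → ℂ) (θ : ℝ),
      |θ| ≤ 2 * Real.pi ∧ geod χ θ 1 = mul (inv x) y ∧ |θ| ≤ q} = 0 := by
  obtain ⟨_, ⟨A₀, B₀, hA, hB, hA0, hB0, -, hBv, rfl⟩, hm⟩ := exists_lt_of_lt_csSup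
    (by exact ⟨_, {x}, E, subset_rfl, subset_rfl, singleton_nonempty x, hE, by simp, by simp, rfl⟩)
    hq
  refine measure_mono_null ?_ hBv
  rintro y ⟨hy, χ, θ, h1, h2, h3⟩
  refine ⟨hy, fun hyB => ?_⟩
  obtain ⟨a, ha⟩ := hA0
  obtain rfl : a = x := hA ha
  refine absurd (hm.trans_le (csInf_le ⟨0, ?_⟩ ⟨a, ha, y, hyB, χ, θ, h1, h2, rfl⟩)) (not_lt.2 h3)
  rintro _ ⟨_, _, _, _, _, _, _, _, rfl⟩
  exact abs_nonneg _

theorem exists_measurable_subset_Theta_le (x : H n) {E : Set (H n)} (hE : E.Nonempty)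
    (hEm : NullMeasurableSet E volume) :
    ∃ E₁ ⊆ E, MeasurableSet E₁ ∧ volume E₁ = volume E ∧ ∀ (χ : Fin n → ℂ) (θ : ℝ),
      |θ| ≤ 2 * Real.pi → mul x (geod χ θ 1) ∈ E₁ → Theta {x} E ≤ |θ| := by
  obtain ⟨E₀, h0, h0m, h0e⟩ := hEm.exists_measurable_subset_ae_eq
  -- Rational thresholds keep the union countable, hence null.
  set N : Set (H n) := ⋃ q ∈ {q : ℚ | (q : ℝ) < Theta {x} E}, {y ∈ E | ∃ (χ : Fin n → ℂ) (θ : ℝ),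
      |θ| ≤ 2 * Real.pi ∧ geod χ θ 1 = mul (inv x) y ∧ |θ| ≤ q} with hN
  have hN0 : volume N = 0 :=
    (measure_biUnion_null_iff (to_countable _)).2 fun q hq => volume_angle_le_eq_zero x hE hq
  refine ⟨E₀ \ toMeasurable volume N, sdiff_subset.trans h0,
    h0m.diff (measurableSet_toMeasurable _ _), ?_, ?_⟩
  · rw [measure_sdiff_null (by rw [measure_toMeasurable, hN0]), measure_congr h0e]
  · rintro χ θ hθ ⟨h1, h2⟩
    by_contra h3
    obtain ⟨q, hq1, hq2⟩ := exists_rat_btwn (not_le.1 h3)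
    refine h2 (subset_toMeasurable _ _ ?_)
    rw [hN, mem_iUnion₂]
    exact ⟨q, hq2, h0 h1, χ, θ, hθ, (inv_mul_cancel_left' _ _).symm, hq1.le⟩

/-- Otherwise no curve with `|θ| < 2π` ends in the full-measure part `E₁`, although such curves
reach almost every point. -/
theorem Theta_lt_two_pi (hn : 1 ≤ n) (x : H n) {E : Set (H n)} (hE : E.Nonempty)
    (hEm : NullMeasurableSet E volume) (h0 : volume E ≠ 0) : Theta {x} E < 2 * Real.pi := by
  obtain ⟨E₁, -, hm, hv, hT⟩ := exists_measurable_subset_Theta_le x hE hEm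
  by_contra h
  apply h0
  have hp := measurePreserving_mul_left x
  rw [← hv, ← hp.measure_preimage hm.nullMeasurableSet,
    volume_eq_lintegral_jac hn (hp.measurable hm)]
  rw [setLIntegral_congr_fun (g := fun _ => 0) measurableSet_angles, lintegral_zero]
  intro θ hθ
  have : ∀ χ : Fin n → ℂ, geod χ θ 1 ∉ mul x ⁻¹' E₁ := fun χ hχ =>
    h ((hT χ θ hθ.2.le hχ).trans_lt hθ.2)
  simp [this]

/-! ### The measure contraction inequality -/

theorem tau_pow_mul_volume_le (hn : 1 ≤ n) (x : H n) {s : ℝ} (hs : s ∈ Ioc (0 : ℝ) 1)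
    {E : Set (H n)} (hE : E.Nonempty) (hEm : NullMeasurableSet E volume)
    (hT : Theta {x} E < 2 * Real.pi) :
    tau n s (Theta {x} E) ^ (2 * n + 1) * volume E ≤ volume (Z s {x} E) := by
  obtain ⟨E₁, hsub, hm, hv, hTle⟩ := exists_measurable_subset_Theta_le x hE hEm
  have hp := measurePreserving_mul_left x
  -- `Z s {x} E` need not be measurable, so it is replaced by a measurable hull of equal outer
  -- measure.
  set A := toMeasurable volume (Z s {x} E) with hA
  have hAm : MeasurableSet A := measurableSet_toMeasurable _ _
  rw [← measure_toMeasurable (Z s {x} E), ← hA, ← hv, ← hp.measure_preimage hm.nullMeasurableSet,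
    ← hp.measure_preimage hAm.nullMeasurableSet, volume_eq_lintegral_jac hn (hp.measurable hm)]
  refine le_trans ?_ (lintegral_jac_le hs (hp.measurable hAm))
  rw [← lintegral_const_mul' _ _ (ENNReal.pow_ne_top (tau_ne_top n s hT.ne))]
  refine setLIntegral_mono' measurableSet_angles fun θ hθ => ?_
  -- Angles below `Theta {x} E` contribute nothing, as no such curve ends in `E₁`.
  by_cases hθT : Theta {x} E ≤ |θ|
  · rw [← mul_assoc]
    have hj : 0 ≤ jac n 1 θ := jac_nonneg ⟨one_pos, le_rfl⟩ hθ
    refine mul_le_mul' ?_ (lintegral_mono fun χ => mul_le_mul_right ?_ _)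
    · rw [jac_eq hn hs hθ, ENNReal.ofReal_mul' hj]
      exact mul_le_mul_left (tau_pow_le hn hs (Theta_nonneg _ _) hθT hθ.1 hθ.2) _
    · by_cases h : geod χ θ 1 ∈ mul x ⁻¹' E₁
      · have h2 : geod χ θ s ∈ mul x ⁻¹' A := subset_toMeasurable _ _
          (mul_geod_mem_Z hθ.1 hθ.2 χ ⟨hs.1.le, hs.2⟩ (hsub h))
        rw [indicator_of_mem h, indicator_of_mem h2]
        rfl
      · rw [indicator_of_notMem h]
        exact zero_le
  · have : ∀ χ : Fin n → ℂ, geod χ θ 1 ∉ mul x ⁻¹' E₁ := fun χ hχ => hθT (hTle χ θ hθ.2.le hχ)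
    simp [this]

end Heisenberg

theorem corollary4p1 (n : ℕ) (hn : 1 ≤ n) (x : Heisenberg.H n) (s : ℝ) (hs : s ∈ Set.Icc (0 : ℝ) 1)
    (E : Set (Heisenberg.H n)) (hE : E.Nonempty) (hEm : NullMeasurableSet E volume) :
    Heisenberg.tau n s (Heisenberg.Theta {x} E) ^ (2 * n + 1) * volume E
        ≤ volume (Heisenberg.Z s {x} E) ∧
      ENNReal.ofReal (s ^ (2 * n + 3)) * volume E
        ≤ Heisenberg.tau n s (Heisenberg.Theta {x} E) ^ (2 * n + 1) * volume E := by
  -- Only here can `Theta {x} E = 2π`, where the coefficient is infinite; `∞ · 0 = 0` settles it.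
  by_cases h0 : volume E = 0
  · simp [h0]
  have hT := Heisenberg.Theta_lt_two_pi hn x hE hEm h0
  -- At `s = 0` the coordinates degenerate, but the coefficient vanishes too.
  rcases hs.1.eq_or_lt with rfl | hs0
  · rw [Heisenberg.tau_zero_left n hT.ne]
    simp
  · exact ⟨Heisenberg.tau_pow_mul_volume_le hn x ⟨hs0, hs.2⟩ hE hEm hT, mul_le_mul_left
      (Heisenberg.ofReal_pow_le_tau_pow hn ⟨hs0, hs.2⟩ ⟨Heisenberg.Theta_nonneg _ _, hT⟩) _⟩
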